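/- Let $B=B_R(x_0)\subset\mathbb R^2$ be an open ball, $R>0$, and $\tfrac12B=B_{R/2}(x_0)$. For $0<\nu\le\Lambda<\infty$ let $\mathcal A_B(\nu,\Lambda)$ be the set of all $a\in L^\infty(B;\mathbb R^{2\times2})$ such that, for almost every $x\in B$, the matrix $a(x)$ is symmetric and $\nu|z|^2\le a(x)z\cdot z\le\Lambda|z|^2$ for every $z\in\mathbb R^2$. A function $v\in W^{1,2}(B)$ is a subsolution for $a$ if $\int_B a\nabla v\cdot\nabla\varphi\,dx\le0$ for all $\varphi\in C^1_c(B)$ with $\varphi\ge0$. Write $v_+=\max\{v,0\}$, and $\sup$ for the essential supremum. (i) There is a universal constant $c<\infty$ such that for every ball $B$, all $0<\nu\le\Lambda<\infty$, every $a\in\mathcal A_B(\nu,\Lambda)$ and every subsolution $v\in W^{1,2}(B)$ for $a$, $$\sup_{\frac12B}v\le c\Bigl(\frac\Lambda\nu\Bigr)^{1/4}\Bigl(\frac1{|B|}\int_B(v_+)^2\,dx\Bigr)^{1/2}.$$ (ii) The exponent $\tfrac14$ is optimal: for every ball $B$ and every real $\theta<\tfrac14$ there is no finite constant $c$ such that $\sup_{\frac12B}v\le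 c(\Lambda/\nu)^{\theta}\bigl(\frac1{|B|}\int_B(v_+)^2\,dx\bigr)^{1/2}$ holds for all $0<\nu\le\Lambda<\infty$, all $a\in\mathcal A_B(\nu,\Lambda)$ and all subsolutions $v\in W^{1,2}(B)$ for $a$. (iii) This is shown by an explicit example on the unit ball $B_1=B_1(0)$: there is $c_0>0$ such that for every $\Lambda\ge1$ the coefficient $a=\mathrm{diag}(1,\Lambda)$ belongs to $\mathcal A_{B_1}(1,\Lambda)$, the function $v(x)=1+x_2^2-\Lambda x_1^2$ is in $W^{1,2}(B_1)$ and is a subsolution for $a$, $\int_{B_1}(v_+)^2\,dx>0$, and $$\sup_{B_{1/2}}v\ge c_0\,\Lambda^{1/4}\Bigl(\frac1{|B_1|}\int_{B_1}(v_+)^2\,dx\Bigr)^{1/2}.$$ -/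

import Mathlib

open MeasureTheory Metric
open scoped ENNReal ContDiff Gradient Matrix

/-- The Euclidean plane `ℝ²` (with its Euclidean norm and Lebesgue measure). -/
abbrev Plane : Type := EuclideanSpace ℝ (Fin 2)

/-- `v ∈ L²(B)` and its distributional gradient on `B` is (represented by) the field
`G ∈ L²(B; ℝ²)`: for every `φ ∈ C_c^∞(B)` and `i = 1, 2` one has
`∫_B v ∂ᵢφ = - ∫_B φ Gᵢ`. -/
structure HasW12Gradient (B : Set Plane) (v : Plane → ℝ) (G : Plane → Plane) : Prop where
  memLp : MemLp v 2 (volume.restrict B)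
  memLp_grad : MemLp G 2 (volume.restrict B)
  integral_eq : ∀ φ : Plane → ℝ, ContDiff ℝ ∞ φ → HasCompactSupport φ → tsupport φ ⊆ B →
    ∀ i : Fin 2, ∫ x in B, v x * (∇ φ x) i = - ∫ x in B, φ x * (G x) i

/-- `v ∈ W^{1,2}(B)`. -/
def MemW12 (B : Set Plane) (v : Plane → ℝ) : Prop :=
  ∃ G : Plane → Plane, HasW12Gradient B v G

/-- `a ∈ L^∞(B; ℝ^{2×2})` is symmetric and satisfies `ν|z|² ≤ a(x)z·z ≤ Λ|z|²` for all `z`, for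
almost every `x ∈ B`. -/
structure IsEllipticOn (B : Set Plane) (ν Λ : ℝ) (a : Plane → Matrix (Fin 2) (Fin 2) ℝ) :
    Prop where
  memLp : ∀ i j, MemLp (fun x => a x i j) ∞ (volume.restrict B)
  symm : ∀ᵐ x ∂(volume.restrict B), (a x).IsSymm
  bounds : ∀ᵐ x ∂(volume.restrict B), ∀ z : Plane,
    ν * ‖z‖ ^ 2 ≤ (a x *ᵥ z.ofLp) ⬝ᵥ z.ofLp ∧ (a x *ᵥ z.ofLp) ⬝ᵥ z.ofLp ≤ Λ * ‖z‖ ^ 2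

/-- `v` is a subsolution, `-div (a ∇v) ≤ 0` in `B`: the weak gradient `G = ∇v ∈ L²` (unique up to
null sets in the open set `B`) satisfies `∫_B a ∇v · ∇φ ≤ 0` for all `0 ≤ φ ∈ C_c^1(B)`. -/
def IsSubsolution (B : Set Plane) (a : Plane → Matrix (Fin 2) (Fin 2) ℝ) (v : Plane → ℝ) :
    Prop :=
  ∃ G : Plane → Plane, HasW12Gradient B v G ∧
    ∀ φ : Plane → ℝ, ContDiff ℝ 1 φ → HasCompactSupport φ → tsupport φ ⊆ B → (∀ x, 0 ≤ φ x) →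
      ∫ x in B, (a x *ᵥ (G x).ofLp) ⬝ᵥ (∇ φ x).ofLp ≤ 0

/-- The essential supremum of a real function over a set, as an extended real number. -/
noncomputable def supOn (S : Set Plane) (v : Plane → ℝ) : EReal :=
  essSup (fun x => (v x : EReal)) (volume.restrict S)

/-- The averaged norm `(⨍_B (v_+)²)^{1/2}` of the positive part `v_+ = max {v, 0}`. -/
noncomputable def posPartAvgNorm (B : Set Plane) (v : Plane → ℝ) : ℝ :=
  (⨍ x in B, (max (v x) 0) ^ 2) ^ (1 / 2 : ℝ)

/-- With the constant `c` and the exponent `θ`, the bound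
`sup_{½B} v ≤ c (Λ/ν)^θ (⨍_B (v_+)²)^{1/2}`, `B = B_R(x₀)`, holds for all ellipticity constants
`0 < ν ≤ Λ`, all coefficient fields with these constants and all subsolutions. -/
def LocalMaxEstimate (x₀ : Plane) (R c θ : ℝ) : Prop :=
  ∀ ν Λ : ℝ, 0 < ν → ν ≤ Λ →
    ∀ a : Plane → Matrix (Fin 2) (Fin 2) ℝ, IsEllipticOn (ball x₀ R) ν Λ a →
      ∀ v : Plane → ℝ, MemW12 (ball x₀ R) v → IsSubsolution (ball x₀ R) a v →
        supOn (ball x₀ (R / 2)) v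
          ≤ ((c * (Λ / ν) ^ θ * posPartAvgNorm (ball x₀ R) v : ℝ) : EReal)

/-! ### Smoothed positive parts -/

/-! Write `u = v₊` and `l = √(Λ/ν)`. Three facts give the upper bound. Caccioppoli's inequality
bounds `∫|∇u|²` by `C l² R⁻² ∫u²`; only the first power of `Λ/ν` appears, because the form of a
symmetric matrix satisfies Cauchy–Schwarz (`form_absorb`, `caccioppoli`). Next, the boundary of a
planar square consists of line segments, and on a segment a function is controlled by its
one-dimensional `W^{1,1}` norm. Averaging over concentric squares yields one whose frame satisfies
`sup u² ≤ C R⁻¹ ∫ (u²/R + |∇(u²)|)` (`exists_frame_bound`). Young's inequality with weight `l`,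
`2u|∇u| ≤ (l/R)u² + (R/l)|∇u|²`, balances this against Caccioppoli and leaves `sup u² ≤ C l R⁻² ∫u²`
on the frame; the square root produces the exponent `1/4` (`exists_frame_bound_of_subsolution`).
Finally, the maximum principle carries the bound into the square, which contains the half ball
(`max_principle_of_frame`).

Two regularizations make this rigorous. The test functions must be `C¹`, so `t₊` is replaced by
`smoothPos ε t`. Restriction to a frame needs continuity, so `v` is replaced by a mollification `w`,
which satisfies the tested inequality up to `Λ * gradError`. In `ae_le_of_subsolution` the
mollification error tends to zero with `ε` fixed, and `ε → 0` comes last.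

For optimality, `1 + y₂² - Λ y₁²` solves the equation for `diag(1, Λ)` and equals `1` at the centre,
but is positive only in a strip of width of order `Λ^(-1/2)`. Its averaged norm is therefore at most
of order `Λ^(-1/4)`. -/

theorem hasDerivAt_posPart_sq (t : ℝ) :
    HasDerivAt (fun s : ℝ => (max s 0) ^ 2) (2 * max t 0) t := by
  rcases lt_trichotomy t 0 with ht | rfl | ht
  · rw [max_eq_right ht.le, mul_zero]
    refine (hasDerivAt_const t (0 : ℝ)).congr_of_eventuallyEq ?_
    filter_upwards [gt_mem_nhds ht] with s hs
    simp [max_eq_right hs.le]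
  · rw [hasDerivAt_iff_isLittleO]
    have h : (fun s : ℝ => s ^ 2) =o[nhds 0] fun s : ℝ => s := by
      simpa using Asymptotics.isLittleO_pow_id (𝕜 := ℝ) one_lt_two
    refine Asymptotics.IsBigO.trans_isLittleO (Asymptotics.IsBigO.of_bound 1 ?_) (by simpa using h)
    filter_upwards with s
    rcases le_total s 0 with hs | hs <;> simp [hs, sq_nonneg]
  · rw [max_eq_left ht.le]
    have h : HasDerivAt (fun s : ℝ => s ^ 2) (2 * t) t := by simpa using hasDerivAt_pow 2 t
    refine h.congr_of_eventuallyEq ?_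
    filter_upwards [lt_mem_nhds ht] with s hs
    simp [max_eq_left hs.le]

theorem contDiff_posPart_sq : ContDiff ℝ 1 (fun s : ℝ => (max s 0) ^ 2) := by
  rw [contDiff_one_iff_deriv]
  refine ⟨fun t => (hasDerivAt_posPart_sq t).differentiableAt, ?_⟩
  have : deriv (fun s : ℝ => (max s 0) ^ 2) = fun t => 2 * max t 0 :=
    funext fun t => (hasDerivAt_posPart_sq t).deriv
  rw [this]
  fun_prop

/-- A continuously differentiable approximation `√(ε² + t₊²) - ε` of the positive part. -/
noncomputable def smoothPos (ε t : ℝ) : ℝ := √(ε ^ 2 + (max t 0) ^ 2) - ε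

/-- The derivative of `smoothPos ε`. -/
noncomputable def smoothPosDeriv (ε t : ℝ) : ℝ := max t 0 / √(ε ^ 2 + (max t 0) ^ 2)

section smoothPos

variable {ε : ℝ} (hε : 0 < ε) (t : ℝ)
include hε

theorem hasDerivAt_smoothPos : HasDerivAt (smoothPos ε) (smoothPosDeriv ε t) t := by
  have h : 0 < ε ^ 2 + (max t 0) ^ 2 := by positivity
  have := (((hasDerivAt_posPart_sq t).const_add (ε ^ 2)).sqrt h.ne').sub_const ε
  refine this.congr_deriv ?_
  unfold smoothPosDeriv
  field_simp

theorem continuous_smoothPosDeriv : Continuous (smoothPosDeriv ε) := by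
  unfold smoothPosDeriv
  refine Continuous.div (by fun_prop) (by fun_prop) fun s => ?_
  have : 0 < ε ^ 2 + (max s 0) ^ 2 := by positivity
  positivity

theorem contDiff_smoothPos : ContDiff ℝ 1 (smoothPos ε) := by
  rw [contDiff_one_iff_deriv]
  refine ⟨fun t => (hasDerivAt_smoothPos hε t).differentiableAt, ?_⟩
  rw [show deriv (smoothPos ε) = smoothPosDeriv ε from
    funext fun t => (hasDerivAt_smoothPos hε t).deriv]
  exact continuous_smoothPosDeriv hε

theorem smoothPosDeriv_nonneg : 0 ≤ smoothPosDeriv ε t := by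
  unfold smoothPosDeriv; positivity

theorem smoothPosDeriv_le_one : smoothPosDeriv ε t ≤ 1 := by
  unfold smoothPosDeriv
  refine div_le_one_of_le₀ (Real.le_sqrt_of_sq_le ?_) (by positivity)
  nlinarith [sq_nonneg ε]

omit hε in
theorem smoothPos_nonneg : 0 ≤ smoothPos ε t := by
  have : ε ≤ √(ε ^ 2 + (max t 0) ^ 2) := Real.le_sqrt_of_sq_le (by nlinarith [sq_nonneg (max t 0)])
  unfold smoothPos; linarith

omit hε in
theorem sub_le_smoothPos : t - ε ≤ smoothPos ε t := by
  have : max t 0 ≤ √(ε ^ 2 + (max t 0) ^ 2) := Real.le_sqrt_of_sq_le (by nlinarith [sq_nonneg ε])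
  have := le_max_left t 0
  unfold smoothPos; linarith

/-- With `q = √(ε² + t₊²)`, the right side minus the left is `ε(q - ε)/q ≥ 0`. -/
theorem smoothPos_le_mul : smoothPos ε t ≤ max t 0 * smoothPosDeriv ε t := by
  have h : 0 < ε ^ 2 + (max t 0) ^ 2 := by positivity
  have h1 : ε ≤ √(ε ^ 2 + (max t 0) ^ 2) := Real.le_sqrt_of_sq_le (by nlinarith [sq_nonneg (max t 0)])
  have h2 := Real.sq_sqrt h.le
  have h3 := Real.sqrt_pos.2 h
  unfold smoothPos smoothPosDeriv
  rw [← mul_div_assoc, le_div_iff₀ h3]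
  nlinarith

theorem smoothPos_le_posPart : smoothPos ε t ≤ max t 0 :=
  (smoothPos_le_mul hε t).trans
    (mul_le_of_le_one_right (le_max_right _ _) (smoothPosDeriv_le_one hε t))

/-- This is the compatibility between a nonlinearity and its derivative that `form_absorb` needs:
the cross term in Caccioppoli's inequality can be absorbed into a gradient term carrying the weight
`smoothPosDeriv`. -/
theorem smoothPos_sq_le : smoothPos ε t ^ 2 ≤ (max t 0) ^ 2 * smoothPosDeriv ε t := by
  have h0 := smoothPosDeriv_nonneg hε t
  calc smoothPos ε t ^ 2 ≤ (max t 0 * smoothPosDeriv ε t) ^ 2 :=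
        pow_le_pow_left₀ (smoothPos_nonneg t) (smoothPos_le_mul hε t) 2
    _ = (max t 0) ^ 2 * (smoothPosDeriv ε t * smoothPosDeriv ε t) := by ring
    _ ≤ (max t 0) ^ 2 * smoothPosDeriv ε t := by
        gcongr; exact mul_le_of_le_one_right h0 (smoothPosDeriv_le_one hε t)

omit hε in
theorem smoothPos_pos (ht : 0 < t) : 0 < smoothPos ε t := by
  have : ε < √(ε ^ 2 + (max t 0) ^ 2) :=
    Real.lt_sqrt_of_sq_lt (by rw [max_eq_left ht.le]; nlinarith [sq_pos_of_pos ht])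
  unfold smoothPos; linarith

theorem smoothPos_of_nonpos (ht : t ≤ 0) : smoothPos ε t = 0 := by
  simp [smoothPos, max_eq_right ht, Real.sqrt_sq hε.le]

theorem abs_smoothPos_sub_le (s : ℝ) : |smoothPos ε t - smoothPos ε s| ≤ |t - s| := by
  have := Convex.norm_image_sub_le_of_norm_hasDerivWithin_le (f := smoothPos ε)
    (f' := smoothPosDeriv ε) (C := 1) (s := Set.univ) (x := s) (y := t)
    (fun x _ => (hasDerivAt_smoothPos hε x).hasDerivWithinAt)
    (fun x _ => by
      rw [Real.norm_of_nonneg (smoothPosDeriv_nonneg hε x)]; exact smoothPosDeriv_le_one hε x)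
    convex_univ trivial trivial
  simpa using this

end smoothPos

/-! ### Gradients in the plane -/

theorem gradient_apply (f : Plane → ℝ) (x : Plane) (i : Fin 2) :
    (∇ f x) i = fderiv ℝ f x (EuclideanSpace.single i 1) := by
  rw [← InnerProductSpace.toDual_symm_apply (𝕜 := ℝ), EuclideanSpace.inner_single_right]
  simp [gradient]

theorem norm_gradient (f : Plane → ℝ) (x : Plane) : ‖∇ f x‖ = ‖fderiv ℝ f x‖ := by
  simp [gradient]

theorem continuous_gradient {f : Plane → ℝ} (hf : ContDiff ℝ 1 f) : Continuous (∇ f) :=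
  (LinearIsometryEquiv.continuous _).comp (hf.continuous_fderiv one_ne_zero)

theorem gradient_comp {f : Plane → ℝ} {h : ℝ → ℝ} {h' : ℝ} {x : Plane}
    (hh : HasDerivAt h h' (f x)) (hf : DifferentiableAt ℝ f x) :
    ∇ (fun y => h (f y)) x = h' • ∇ f x := by
  have := (hh.comp_hasFDerivAt x hf.hasFDerivAt).fderiv
  simp only [gradient]
  rw [show (fun y => h (f y)) = h ∘ f from rfl, this, map_smul]

theorem gradient_mul {f h : Plane → ℝ} {x : Plane}
    (hf : DifferentiableAt ℝ f x) (hh : DifferentiableAt ℝ h x) :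
    ∇ (fun y => f y * h y) x = f x • ∇ h x + h x • ∇ f x := by
  simp only [gradient]
  rw [fderiv_fun_mul hf hh, map_add, map_smul, map_smul]

theorem norm_sq_eq (z : Plane) : ‖z‖ ^ 2 = z 0 ^ 2 + z 1 ^ 2 := by
  rw [EuclideanSpace.norm_sq_eq]; simp

/-! ### Quadratic forms -/

theorem mulVec_dotProduct_eq (M : Matrix (Fin 2) (Fin 2) ℝ) (z y : Plane) :
    (M *ᵥ z.ofLp) ⬝ᵥ y.ofLp =
      (M 0 0 * z 0 + M 0 1 * z 1) * y 0 + (M 1 0 * z 0 + M 1 1 * z 1) * y 1 := by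
  simp [Matrix.mulVec, dotProduct, Fin.sum_univ_two]

section form

variable {M : Matrix (Fin 2) (Fin 2) ℝ} {ν Λ : ℝ} (hM : M.IsSymm)
  (hb : ∀ z : Plane, ν * ‖z‖ ^ 2 ≤ (M *ᵥ z.ofLp) ⬝ᵥ z.ofLp ∧
    (M *ᵥ z.ofLp) ⬝ᵥ z.ofLp ≤ Λ * ‖z‖ ^ 2) (hν : 0 < ν)
include hM hb hν

/-- Cauchy–Schwarz from the discriminant of `t ↦ M(z + ty)·(z + ty) ≥ 0`; symmetry merges the two
cross terms. -/
theorem form_sq_le (z y : Plane) :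
    ((M *ᵥ z.ofLp) ⬝ᵥ y.ofLp) ^ 2 ≤
      ((M *ᵥ z.ofLp) ⬝ᵥ z.ofLp) * ((M *ᵥ y.ofLp) ⬝ᵥ y.ofLp) := by
  have key : ∀ t : ℝ, 0 ≤ ((M *ᵥ y.ofLp) ⬝ᵥ y.ofLp) * (t * t)
      + (2 * ((M *ᵥ z.ofLp) ⬝ᵥ y.ofLp)) * t + (M *ᵥ z.ofLp) ⬝ᵥ z.ofLp := by
    intro t
    have h := (hb (z + t • y)).1
    have h0 : 0 ≤ ν * ‖z + t • y‖ ^ 2 := by positivity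
    have hs : M 1 0 = M 0 1 := hM.apply 0 1
    refine (h0.trans h).trans_eq ?_
    simp only [mulVec_dotProduct_eq, PiLp.add_apply, PiLp.smul_apply, smul_eq_mul, hs]
    ring
  have := discrim_le_zero key
  unfold discrim at this
  nlinarith

theorem abs_form_le (z y : Plane) : |(M *ᵥ z.ofLp) ⬝ᵥ y.ofLp| ≤ Λ * ‖z‖ * ‖y‖ := by
  have hnn : ∀ z : Plane, 0 ≤ (M *ᵥ z.ofLp) ⬝ᵥ z.ofLp := fun z =>
    le_trans (by positivity) (hb z).1
  have hΛ : 0 ≤ Λ := by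
    have h1 := hb (EuclideanSpace.single 0 1)
    have : ν * 1 ≤ Λ * 1 := by simpa using h1.1.trans h1.2
    linarith
  refine abs_le_of_sq_le_sq ?_ (by positivity)
  calc ((M *ᵥ z.ofLp) ⬝ᵥ y.ofLp) ^ 2
      ≤ ((M *ᵥ z.ofLp) ⬝ᵥ z.ofLp) * ((M *ᵥ y.ofLp) ⬝ᵥ y.ofLp) := form_sq_le hM hb hν z y
    _ ≤ (Λ * ‖z‖ ^ 2) * (Λ * ‖y‖ ^ 2) :=
        mul_le_mul (hb z).2 (hb y).2 (hnn y) (by positivity)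
    _ = (Λ * ‖z‖ * ‖y‖) ^ 2 := by ring

/-- The pointwise absorption behind Caccioppoli's inequality. -/
theorem form_absorb {ζ g g' t k : ℝ} (z y : Plane) (hζ : 0 ≤ ζ) (hg' : 0 ≤ g')
    (hg : g ^ 2 ≤ t ^ 2 * g') (hy : ‖y‖ ^ 2 ≤ k * ζ) (hk : 0 ≤ k) :
    ν / 2 * (ζ * g' * ‖z‖ ^ 2) - k * Λ / 2 * t ^ 2 ≤
      (M *ᵥ z.ofLp) ⬝ᵥ ((ζ * g') • z + g • y).ofLp := by
  have hzz := hb z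
  have hyy := hb y
  have hcs := form_sq_le hM hb hν z y
  have hΛ : 0 ≤ Λ := by
    have h1 := hb (EuclideanSpace.single 0 1)
    have : ν * 1 ≤ Λ * 1 := by simpa using h1.1.trans h1.2
    linarith
  have hexp : (M *ᵥ z.ofLp) ⬝ᵥ ((ζ * g') • z + g • y).ofLp =
      ζ * g' * ((M *ᵥ z.ofLp) ⬝ᵥ z.ofLp) + g * ((M *ᵥ z.ofLp) ⬝ᵥ y.ofLp) := by
    simp [dotProduct_add, dotProduct_smul]
  rw [hexp]
  set q := (M *ᵥ z.ofLp) ⬝ᵥ z.ofLp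
  set p := (M *ᵥ z.ofLp) ⬝ᵥ y.ofLp
  have hq : 0 ≤ q := le_trans (by positivity) hzz.1
  -- The cross term is at most the geometric mean of the good term `ζ g' q` and `k Λ t²`. The
  -- arithmetic–geometric mean inequality then uses up only half of the good term. Bounding `p` by
  -- `Λ‖z‖‖y‖` instead would lead to `Λ²/ν` in place of `Λ`.
  have hsq : (g * p) ^ 2 ≤ (ζ * g' * q) * (k * Λ * t ^ 2) := by
    calc (g * p) ^ 2 = g ^ 2 * p ^ 2 := by ring
      _ ≤ (t ^ 2 * g') * (q * (Λ * (k * ζ))) := by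
          refine mul_le_mul hg (hcs.trans ?_) (sq_nonneg _) (by positivity)
          exact mul_le_mul_of_nonneg_left
            (hyy.2.trans (mul_le_mul_of_nonneg_left hy hΛ)) hq
      _ = _ := by ring
  have ha : 0 ≤ ζ * g' * q := by positivity
  have hb' : 0 ≤ k * Λ * t ^ 2 := by positivity
  have hab : |g * p| ≤ (ζ * g' * q + k * Λ * t ^ 2) / 2 := by
    refine abs_le_of_sq_le_sq ?_ (by positivity)
    nlinarith [sq_nonneg (ζ * g' * q - k * Λ * t ^ 2)]
  have h1 := (abs_le.1 hab).1
  have h2 : ζ * g' * (ν * ‖z‖ ^ 2) ≤ ζ * g' * q :=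
    mul_le_mul_of_nonneg_left hzz.1 (by positivity)
  nlinarith

end form

/-! ### Mollification -/

/-- Continuity of translations in `L²`: they preserve the measure and depend continuously on `t` in
`C(Plane, Plane)`, so composition with a fixed `L²` class is continuous in `t`. -/
theorem tendsto_lintegral_translate {f : Plane → ℝ} (hf : MemLp f 2 volume) {ε : ℝ≥0∞}
    (hε : 0 < ε) : ∃ η : ℝ, 0 < η ∧ ∀ t : Plane, ‖t‖ < η →
      ∫⁻ x, ‖f (x - t) - f x‖ₑ ^ 2 ≤ ε := by
  have hmp : ∀ t : Plane, MeasurePreserving (fun x : Plane => x - t) volume volume :=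
    fun t => measurePreserving_sub_right volume t
  let g : Plane → C(Plane, Plane) := fun t => ⟨fun x => x - t, by fun_prop⟩
  have hg : Continuous g :=
    ContinuousMap.continuous_of_continuous_uncurry _ (by
      change Continuous fun p : Plane × Plane => p.2 - p.1
      fun_prop)
  have hF := Continuous.compMeasurePreservingLp (μ := volume) (ν := volume) (p := 2)
    (f := fun _ : Plane => hf.toLp f) continuous_const hg hmp (by simp)
  have hlim : Filter.Tendsto (fun t : Plane => eLpNorm (fun x => f (x - t) - f x) 2 volume)
      (nhds 0) (nhds 0) := by
    have h1 := tendsto_iff_edist_tendsto_0.1 (hF.tendsto 0)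
    refine h1.congr fun t => ?_
    rw [Lp.edist_def]
    refine eLpNorm_congr_ae ?_
    have a1 := Lp.coeFn_compMeasurePreserving (hf.toLp f) (hmp t)
    have a2 := Lp.coeFn_compMeasurePreserving (hf.toLp f) (hmp 0)
    have a3 := (hmp t).quasiMeasurePreserving.ae_eq_comp hf.coeFn_toLp
    have a4 := (hmp 0).quasiMeasurePreserving.ae_eq_comp hf.coeFn_toLp
    filter_upwards [a1, a2, a3, a4] with x b1 b2 b3 b4
    simp only [Pi.sub_apply]
    erw [b1, b2, b3, b4]
    simp
  have hε' : 0 < ε ^ (1 / 2 : ℝ) := by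
    rcases eq_or_ne ε ⊤ with rfl | h
    · simp
    · exact ENNReal.rpow_pos hε h
  obtain ⟨η, hη, h⟩ := Metric.eventually_nhds_iff.1 (hlim.eventually (gt_mem_nhds hε'))
  refine ⟨η, hη, fun t ht => ?_⟩
  have h2 := (h (by simpa using ht : dist t 0 < η)).le
  rw [eLpNorm_eq_lintegral_rpow_enorm_toReal (by simp) (by simp)] at h2
  have h3 := (ENNReal.rpow_le_rpow_iff (by norm_num)).1 h2
  simpa using h3

/-- Since `ρ(t) dt` is a probability measure, `|ρ * f - f|²` at `x` is at most the `ρ`-average of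
`|f(x - t) - f(x)|²` (Jensen, through the monotonicity of `eLpNorm` in the exponent). Tonelli then
reduces the claim to translations by vectors in the support of `ρ`. -/
theorem lintegral_convolution_sub_le {f : Plane → ℝ} (hf : MemLp f 2 volume)
    (hfm : StronglyMeasurable f) {ε : ℝ≥0∞} (hε : 0 < ε) :
    ∃ η : ℝ, 0 < η ∧ ∀ φ : ContDiffBump (0 : Plane), φ.rOut ≤ η →
      ∫⁻ x, ‖convolution (φ.normed volume) f (ContinuousLinearMap.lsmul ℝ ℝ) volume x - f x‖ₑ ^ 2
        ≤ ε := by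
  obtain ⟨η, hη, h⟩ := tendsto_lintegral_translate hf hε
  refine ⟨η, hη, fun φ hφ => ?_⟩
  set ρ := φ.normed volume with hρ
  have hρc : Continuous ρ := φ.continuous_normed
  have hρn : ∀ x, 0 ≤ ρ x := φ.nonneg_normed
  have hρI : ∫ x, ρ x = 1 := φ.integral_normed
  have hρi : Integrable ρ := hρc.integrable_of_hasCompactSupport φ.hasCompactSupport_normed
  let P : Measure Plane := volume.withDensity fun t => ENNReal.ofReal (ρ t)
  have hP : IsProbabilityMeasure P := ⟨by
    rw [withDensity_apply _ MeasurableSet.univ, Measure.restrict_univ,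
      ← ofReal_integral_eq_lintegral_ofReal hρi (.of_forall hρn), hρI, ENNReal.ofReal_one]⟩
  have hmeas : Measurable fun p : Plane × Plane => ‖f (p.1 - p.2) - f p.1‖ₑ ^ 2 := by
    have := hfm.measurable
    fun_prop
  have hloc : LocallyIntegrable f volume := hf.locallyIntegrable (by norm_num)
  have hpt : ∀ x, ‖convolution ρ f (ContinuousLinearMap.lsmul ℝ ℝ) volume x - f x‖ₑ ^ 2 ≤
      ∫⁻ t, ‖f (x - t) - f x‖ₑ ^ 2 ∂P := by
    intro x
    have hex : Integrable fun t => ρ t * f (x - t) :=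
      (φ.hasCompactSupport_normed.convolutionExists_left (ContinuousLinearMap.lsmul ℝ ℝ) hρc
        hloc) x
    have e1 : convolution ρ f (ContinuousLinearMap.lsmul ℝ ℝ) volume x - f x =
        ∫ t, ρ t * (f (x - t) - f x) := by
      simp only [mul_sub]
      rw [integral_sub hex (hρi.mul_const _), integral_mul_const, hρI, one_mul]
      rfl
    have e2 : ‖convolution ρ f (ContinuousLinearMap.lsmul ℝ ℝ) volume x - f x‖ₑ ≤
        eLpNorm (fun t => f (x - t) - f x) 1 P := by
      rw [e1, eLpNorm_one_eq_lintegral_enorm]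
      refine (enorm_integral_le_lintegral_enorm _).trans_eq ?_
      rw [lintegral_withDensity_eq_lintegral_mul _ (by fun_prop)
        (by have := hfm.measurable; fun_prop)]
      refine lintegral_congr fun t => ?_
      simp only [Pi.mul_apply, enorm_mul]
      rw [Real.enorm_of_nonneg (hρn t)]
    have e3 := e2.trans (eLpNorm_le_eLpNorm_of_exponent_le (p := 1) (q := 2) (by norm_num)
      (Measurable.aestronglyMeasurable (by have := hfm.measurable; fun_prop)))
    rw [eLpNorm_eq_lintegral_rpow_enorm_toReal (by simp) (by simp)] at e3
    calc _ ≤ ((∫⁻ t, ‖f (x - t) - f x‖ₑ ^ (2 : ℝ≥0∞).toReal ∂P) ^ (1 / (2 : ℝ≥0∞).toReal)) ^ 2 :=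
          pow_le_pow_left₀ (by simp) e3 2
      _ = _ := by
          rw [← ENNReal.rpow_natCast, ← ENNReal.rpow_mul]
          simp
  calc _ ≤ ∫⁻ x, ∫⁻ t, ‖f (x - t) - f x‖ₑ ^ 2 ∂P := lintegral_mono hpt
    _ = ∫⁻ t, (∫⁻ x, ‖f (x - t) - f x‖ₑ ^ 2) ∂P := lintegral_lintegral_swap hmeas.aemeasurable
    _ = ∫⁻ t, ENNReal.ofReal (ρ t) * ∫⁻ x, ‖f (x - t) - f x‖ₑ ^ 2 := by
        rw [lintegral_withDensity_eq_lintegral_mul _ (by fun_prop)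
          (Measurable.lintegral_prod_left' hmeas)]
        rfl
    _ ≤ ∫⁻ t, ENNReal.ofReal (ρ t) * ε := by
        refine lintegral_mono fun t => ?_
        by_cases ht : ‖t‖ < η
        · exact mul_le_mul_right (h t ht) _
        · have : ρ t = 0 := by
            by_contra h0
            have h1 : t ∈ Function.support ρ := h0
            rw [hρ, φ.support_normed_eq, mem_ball_zero_iff] at h1
            exact ht (h1.trans_le hφ)
          simp [this]
    _ = ε := by
        rw [lintegral_mul_const _ (by fun_prop),
          ← ofReal_integral_eq_lintegral_ofReal hρi (.of_forall hρn), hρI]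
        simp

/-- The derivative falls on the kernel, and `y ↦ ρ(x - y)` is an admissible test function for the
weak gradient because its support stays inside the ball. Here `f` and `h i` represent the extensions
by zero. -/
theorem gradient_convolution {x₀ : Plane} {R r : ℝ} {v : Plane → ℝ} {G : Plane → Plane}
    (hv : HasW12Gradient (ball x₀ R) v G) {f : Plane → ℝ} {h : Fin 2 → Plane → ℝ}
    (hf : f =ᵐ[volume] (ball x₀ R).indicator v)
    (hh : ∀ i, h i =ᵐ[volume] (ball x₀ R).indicator fun x => G x i)
    (hloc : LocallyIntegrable f volume)
    (φ : ContDiffBump (0 : Plane)) (hφ : r + φ.rOut < R) {x : Plane} (hx : x ∈ closedBall x₀ r)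
    (i : Fin 2) :
    (∇ (convolution (φ.normed volume) f (ContinuousLinearMap.lsmul ℝ ℝ) volume) x) i =
      convolution (φ.normed volume) (h i) (ContinuousLinearMap.lsmul ℝ ℝ) volume x := by
  set ρ := φ.normed volume with hρ
  have hρs : ContDiff ℝ ∞ ρ := φ.contDiff_normed
  have hρc : HasCompactSupport ρ := φ.hasCompactSupport_normed
  have hd := (hρc.hasFDerivAt_convolution_left (ContinuousLinearMap.lsmul ℝ ℝ)
    (hρs.of_le (by simp)) hloc x).fderiv
  have hex : ConvolutionExistsAt (fderiv ℝ ρ) f x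
      ((ContinuousLinearMap.lsmul ℝ ℝ).precompL Plane) volume :=
    ((hρc.fderiv ℝ).convolutionExists_left _ (hρs.continuous_fderiv (by simp)) hloc) x
  rw [gradient_apply, hd, convolution_eq_swap, convolution_eq_swap]
  rw [ContinuousLinearMap.integral_apply hex.integrable_swap]
  have hsm : ContDiff ℝ ∞ fun y => ρ (x - y) := hρs.comp (by fun_prop)
  have hts : tsupport (fun y => ρ (x - y)) ⊆ closedBall x φ.rOut := by
    refine closure_minimal (fun y hy => ?_) isClosed_closedBall
    have h1 : x - y ∈ Function.support ρ := hy
    rw [hρ, φ.support_normed_eq, mem_ball_zero_iff] at h1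
    rw [mem_closedBall, dist_comm, dist_eq_norm]
    exact h1.le
  have hkey := hv.integral_eq (fun y => ρ (x - y)) hsm
    (HasCompactSupport.intro' (isCompact_closedBall x φ.rOut) isClosed_closedBall
      fun y hy => image_eq_zero_of_notMem_tsupport (f := fun y => ρ (x - y)) fun h1 => hy (hts h1))
    (hts.trans fun y hy => by
      rw [mem_ball]; rw [mem_closedBall] at hx hy
      linarith [dist_triangle y x x₀]) i
  have hg : ∀ y, (∇ (fun y => ρ (x - y)) y) i = - fderiv ℝ ρ (x - y) (EuclideanSpace.single i 1) := by
    intro y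
    rw [gradient_apply]
    have h1 : HasFDerivAt ρ (fderiv ℝ ρ (x - y)) (x - y) :=
      (hρs.differentiable (by simp) _).hasFDerivAt
    have h2 := (h1.comp y ((hasFDerivAt_id y).const_sub x)).fderiv
    change (fderiv ℝ (ρ ∘ HSub.hSub x) y) _ = _
    rw [h2]
    simp
  simp only [hg, mul_neg, integral_neg, neg_inj] at hkey
  calc _ = ∫ y in ball x₀ R, v y * fderiv ℝ ρ (x - y) (EuclideanSpace.single i 1) := by
        rw [← integral_indicator measurableSet_ball]
        refine integral_congr_ae ?_
        filter_upwards [hf] with y hy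
        rw [hy]
        by_cases hb : y ∈ ball x₀ R <;>
          simp [Set.indicator, hb, ContinuousLinearMap.precompL, mul_comm]
    _ = ∫ y in ball x₀ R, ρ (x - y) * G y i := hkey
    _ = _ := by
        rw [← integral_indicator measurableSet_ball]
        refine integral_congr_ae ?_
        filter_upwards [hh i] with y hy
        rw [hy]
        by_cases hb : y ∈ ball x₀ R <;> simp [Set.indicator, hb]

/-- Functions in `W^{1,2}` of a ball are limits of smooth functions on smaller balls. -/
theorem exists_smooth_approx {x₀ : Plane} {R r : ℝ} (hr : r < R) {v : Plane → ℝ}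
    {G : Plane → Plane} (hv : HasW12Gradient (ball x₀ R) v G) {ε : ℝ≥0∞} (hε : 0 < ε) :
    ∃ w : Plane → ℝ, ContDiff ℝ 1 w ∧ ∫⁻ x in closedBall x₀ r, ‖w x - v x‖ₑ ^ 2 ≤ ε ∧
      ∫⁻ x in closedBall x₀ r, ‖∇ w x - G x‖ₑ ^ 2 ≤ ε + ε := by
  have hex : ∀ u : Plane → ℝ, MemLp u 2 (volume.restrict (ball x₀ R)) →
      ∃ f : Plane → ℝ, StronglyMeasurable f ∧ MemLp f 2 volume ∧
        f =ᵐ[volume] (ball x₀ R).indicator u := by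
    intro u hu
    have h1 := (memLp_indicator_iff_restrict measurableSet_ball).2 hu
    exact ⟨h1.1.mk _, h1.1.stronglyMeasurable_mk, h1.ae_eq h1.1.ae_eq_mk, h1.1.ae_eq_mk.symm⟩
  have hGi : ∀ i, MemLp (fun x => G x i) 2 (volume.restrict (ball x₀ R)) := fun i =>
    hv.memLp_grad.of_le ((EuclideanSpace.proj (𝕜 := ℝ) i).continuous.comp_aestronglyMeasurable
      hv.memLp_grad.1) (.of_forall fun x => PiLp.norm_apply_le (G x) i)
  obtain ⟨f, hfm, hfL, hf⟩ := hex v hv.memLp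
  choose h hhm hhL hh using fun i => hex _ (hGi i)
  obtain ⟨η, hη, H⟩ := lintegral_convolution_sub_le hfL hfm hε
  choose η' hη' H' using fun i => lintegral_convolution_sub_le (hhL i) (hhm i) hε
  obtain ⟨δ, hδ, hδ1⟩ : ∃ δ : ℝ, 0 < δ ∧ δ < R - r ∧ δ ≤ η ∧ δ ≤ η' 0 ∧ δ ≤ η' 1 :=
    ⟨min ((R - r) / 2) (min η (min (η' 0) (η' 1))),
      by simp [hη, hη', hr], lt_of_le_of_lt (min_le_left _ _) (by linarith), by simp, by simp, by simp⟩
  let φ : ContDiffBump (0 : Plane) := ⟨δ / 2, δ, by linarith, by linarith⟩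
  have hloc : LocallyIntegrable f volume := hfL.locallyIntegrable (by norm_num)
  refine ⟨convolution (φ.normed volume) f (ContinuousLinearMap.lsmul ℝ ℝ) volume, ?_, ?_, ?_⟩
  · exact φ.hasCompactSupport_normed.contDiff_convolution_left (n := 1) _ φ.contDiff_normed hloc
  · have hsub : closedBall x₀ r ⊆ ball x₀ R := closedBall_subset_ball hr
    refine le_trans (le_trans (le_of_eq ?_) (setLIntegral_le_lintegral (closedBall x₀ r) _))
      (H φ hδ1.2.1)
    refine setLIntegral_congr_fun_ae measurableSet_closedBall ?_
    filter_upwards [hf] with x hx hxm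
    rw [hx, Set.indicator_of_mem (hsub hxm)]
  · have hsub : closedBall x₀ r ⊆ ball x₀ R := closedBall_subset_ball hr
    -- On the smaller ball the gradient of the mollification is the mollification of the two
    -- components of `G`; each contributes one `ε`.
    have hle : ∫⁻ x in closedBall x₀ r,
        ‖∇ (convolution (φ.normed volume) f (ContinuousLinearMap.lsmul ℝ ℝ) volume) x - G x‖ₑ ^ 2 =
        ∫⁻ x in closedBall x₀ r,
        (‖convolution (φ.normed volume) (h 0) (ContinuousLinearMap.lsmul ℝ ℝ) volume x - h 0 x‖ₑ ^ 2
          + ‖convolution (φ.normed volume) (h 1) (ContinuousLinearMap.lsmul ℝ ℝ) volume x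
            - h 1 x‖ₑ ^ 2) := by
      refine setLIntegral_congr_fun_ae measurableSet_closedBall ?_
      filter_upwards [hh 0, hh 1] with x h0 h1 hxm
      have e := gradient_convolution (r := r) hv hf hh hloc φ (by change r + δ < R; linarith) hxm
      rw [← e 0, ← e 1, h0, h1, Set.indicator_of_mem (hsub hxm), Set.indicator_of_mem (hsub hxm)]
      simp only [← ofReal_norm, ← ENNReal.ofReal_pow (norm_nonneg _)]
      rw [← ENNReal.ofReal_add (by positivity) (by positivity), norm_sq_eq]
      simp
    rw [hle, lintegral_add_left']
    · exact add_le_add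
        ((setLIntegral_le_lintegral _ _).trans (H' 0 φ hδ1.2.2.1))
        ((setLIntegral_le_lintegral _ _).trans (H' 1 φ hδ1.2.2.2))
    · have c : Continuous (convolution (φ.normed volume) (h 0) (ContinuousLinearMap.lsmul ℝ ℝ)
          volume) := (φ.hasCompactSupport_normed.contDiff_convolution_left (n := 1) _
          φ.contDiff_normed ((hhL 0).locallyIntegrable (by norm_num))).continuous
      have := c.measurable
      have := (hhm 0).measurable
      exact Measurable.aemeasurable (by fun_prop)

/-! ### Functions on the frames of concentric squares -/

/-- The distance of `x` from `c` in the maximum norm. -/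
noncomputable def squareDist (c x : Plane) : ℝ := max |x 0 - c 0| |x 1 - c 1|

theorem continuous_squareDist (c : Plane) : Continuous (squareDist c) := by
  unfold squareDist; fun_prop

theorem squareDist_le_dist (c x : Plane) : squareDist c x ≤ dist x c := by
  rw [dist_eq_norm]
  exact max_le (PiLp.norm_apply_le (x - c) 0) (PiLp.norm_apply_le (x - c) 1)

theorem dist_sq_le_squareDist (c x : Plane) : dist x c ^ 2 ≤ 2 * squareDist c x ^ 2 := by
  rw [dist_eq_norm, norm_sq_eq]
  have h0 : |x 0 - c 0| ≤ squareDist c x := le_max_left _ _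
  have h1 : |x 1 - c 1| ≤ squareDist c x := le_max_right _ _
  have := sq_le_sq' (by linarith [abs_nonneg (x 0 - c 0)]) h0
  have := sq_le_sq' (by linarith [abs_nonneg (x 1 - c 1)]) h1
  simp only [sq_abs, PiLp.sub_apply] at *
  linarith

/-- Average `f y ≤ f z + ∫|f'|` over `z ∈ [-L, L]`. -/
theorem le_integral_add_abs_deriv {f f' : ℝ → ℝ} (hf : ∀ t, HasDerivAt f (f' t) t)
    (hf' : Continuous f') {L y : ℝ} (hL : 0 < L) (hy : |y| ≤ L) :
    f y ≤ ∫ t in (-L)..L, (f t / (2 * L) + |f' t|) := by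
  have hfc : Continuous f := continuous_iff_continuousAt.2 fun t => (hf t).continuousAt
  have hyI : y ∈ Set.Icc (-L) L := abs_le.1 hy
  have hbd : ∀ z ∈ Set.Icc (-L) L, f y - f z ≤ ∫ t in (-L)..L, |f' t| := by
    intro z hz
    rw [← intervalIntegral.integral_eq_sub_of_hasDerivAt (fun t _ => hf t)
      (hf'.intervalIntegrable z y)]
    refine (Real.le_norm_self _).trans
      (intervalIntegral.norm_integral_le_integral_norm_uIoc.trans ?_)
    simp only [Real.norm_eq_abs]
    rw [intervalIntegral.integral_of_le (by linarith : -L ≤ L)]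
    refine setIntegral_mono_set (hf'.abs.integrableOn_Ioc) (.of_forall fun t => abs_nonneg _)
      (Filter.Eventually.of_forall fun t ht => ?_)
    exact ⟨lt_of_le_of_lt (le_min hz.1 hyI.1) ht.1, ht.2.trans (max_le hz.2 hyI.2)⟩
  have h1 : ∫ z in (-L)..L, f y / (2 * L) ≤
      ∫ z in (-L)..L, (f z / (2 * L) + (∫ t in (-L)..L, |f' t|) / (2 * L)) := by
    refine intervalIntegral.integral_mono_on (by linarith) (by simp)
      (Continuous.intervalIntegrable (by fun_prop) _ _) fun z hz => ?_
    rw [← add_div]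
    gcongr
    linarith [hbd z hz]
  rw [intervalIntegral.integral_add (Continuous.intervalIntegrable (by fun_prop) _ _) (by simp),
    intervalIntegral.integral_const, intervalIntegral.integral_const] at h1
  rw [intervalIntegral.integral_add (Continuous.intervalIntegrable (by fun_prop) _ _)
    (Continuous.intervalIntegrable (by fun_prop) _ _)]
  simp only [smul_eq_mul] at h1
  have e : ∀ a : ℝ, (L - -L) * (a / (2 * L)) = a := fun a => by field_simp; ring
  rwa [e, e] at h1

theorem setIntegral_square (c : Plane) {L : ℝ} (hL : 0 < L) {ψ : Plane → ℝ} (hψ : Continuous ψ) :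
    ∫ x in {x | squareDist c x ≤ L}, ψ x =
      ∫ s in (-L)..L, ∫ t in (-L)..L, ψ !₂[c 0 + s, c 1 + t] := by
  let e : Plane ≃ᵐ ℝ × ℝ :=
    (MeasurableEquiv.toLp 2 (Fin 2 → ℝ)).symm.trans MeasurableEquiv.finTwoArrow
  have he : MeasurePreserving e volume volume :=
    (EuclideanSpace.volume_preserving_symm_measurableEquiv_toLp (Fin 2)).trans
      (volume_preserving_finTwoArrow ℝ)
  have hset : {x | squareDist c x ≤ L} =
      e ⁻¹' (Set.Icc (c 0 - L) (c 0 + L) ×ˢ Set.Icc (c 1 - L) (c 1 + L)) := by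
    ext x
    change max |x 0 - c 0| |x 1 - c 1| ≤ L ↔
      (c 0 - L ≤ x 0 ∧ x 0 ≤ c 0 + L) ∧ (c 1 - L ≤ x 1 ∧ x 1 ≤ c 1 + L)
    rw [max_le_iff, abs_le, abs_le]
    constructor
    · rintro ⟨⟨h1, h2⟩, h3, h4⟩
      exact ⟨⟨by linarith, by linarith⟩, by linarith, by linarith⟩
    · rintro ⟨⟨h1, h2⟩, h3, h4⟩
      exact ⟨⟨by linarith, by linarith⟩, by linarith, by linarith⟩
  have hψe : ∀ x, ψ x = (fun p : ℝ × ℝ => ψ !₂[p.1, p.2]) (e x) := by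
    intro x
    change ψ x = ψ !₂[x 0, x 1]
    congr 1
    ext i
    fin_cases i <;> rfl
  have hc : Continuous fun p : ℝ × ℝ => ψ !₂[p.1, p.2] := by fun_prop
  rw [hset]
  refine (integral_congr_ae (.of_forall hψe)).trans
    ((he.setIntegral_preimage_emb e.measurableEmbedding (fun p : ℝ × ℝ => ψ !₂[p.1, p.2]) _).trans ?_)
  rw [Measure.volume_eq_prod, setIntegral_prod _
    (hc.continuousOn.integrableOn_compact (isCompact_Icc.prod isCompact_Icc))]
  have e2 : ∀ (φ : ℝ → ℝ) (a : ℝ), ∫ t in (-L)..L, φ (a + t) = ∫ t in Set.Icc (a - L) (a + L), φ t := by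
    intro φ a
    rw [intervalIntegral.integral_comp_add_left, integral_Icc_eq_integral_Ioc,
      intervalIntegral.integral_of_le (by linarith), sub_eq_add_neg]
  rw [← e2]
  refine intervalIntegral.integral_congr fun s _ => ?_
  exact (e2 (fun b => ψ !₂[c 0 + s, b]) (c 1)).symm

theorem setIntegral_square' (c : Plane) {L : ℝ} (hL : 0 < L) {ψ : Plane → ℝ}
    (hψ : Continuous ψ) :
    ∫ x in {x | squareDist c x ≤ L}, ψ x =
      ∫ s in (-L)..L, ∫ t in (-L)..L, ψ !₂[c 0 + t, c 1 + s] := by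
  rw [setIntegral_square c hL hψ, intervalIntegral_intervalIntegral_swap]
  have hc : Continuous (Function.uncurry fun s t : ℝ => ψ !₂[c 0 + s, c 1 + t]) := by
    unfold Function.uncurry; fun_prop
  exact (hc.continuousOn.integrableOn_compact (isCompact_uIcc.prod isCompact_uIcc)).mono_set
    (Set.prod_mono Set.uIoc_subset_uIcc Set.uIoc_subset_uIcc)

/-- A frame has two opposite sides, at `s` and `-s`, in each direction. Folding `[-L, L]` accounts
for both, and the middle interval is discarded by positivity. -/
theorem integral_add_reflect_le {A : ℝ → ℝ} (hA : Continuous A) (hA0 : ∀ s, 0 ≤ A s) {a L : ℝ}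
    (ha : 0 < a) :
    ∫ s in a..L, (A s + A (-s)) ≤ ∫ s in (-L)..L, A s := by
  have hi : ∀ p q, IntervalIntegrable A volume p q := hA.intervalIntegrable
  rw [intervalIntegral.integral_add (hi _ _) (Continuous.intervalIntegrable (by fun_prop) _ _),
    intervalIntegral.integral_comp_neg,
    ← intervalIntegral.integral_add_adjacent_intervals (hi (-L) (-a)) (hi (-a) L),
    ← intervalIntegral.integral_add_adjacent_intervals (hi (-a) a) (hi a L)]
  have : 0 ≤ ∫ s in (-a)..a, A s := intervalIntegral.integral_nonneg (by linarith) fun s _ => hA0 s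
  linarith

/-- On the frame of a suitable square a function is bounded by its `W^{1,1}` norm. -/
theorem exists_frame_bound {u : Plane → ℝ} (hu : ContDiff ℝ 1 u) (hu0 : ∀ x, 0 ≤ u x) (c : Plane)
    {a L : ℝ} (ha : 0 < a) (haL : a < L) :
    ∃ s ∈ Set.Icc a L, ∀ x, squareDist c x = s →
      u x ≤ 2 / (L - a) * ∫ x in {x | squareDist c x ≤ L}, (u x / (2 * L) + ‖∇ u x‖) := by
  have hL : 0 < L := ha.trans haL
  set ψ : Plane → ℝ := fun x => u x / (2 * L) + ‖∇ u x‖ with hψd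
  have huc := hu.continuous
  have hgc := continuous_gradient hu
  have hψ : Continuous ψ := by fun_prop
  have hψ0 : ∀ x, 0 ≤ ψ x := fun x => add_nonneg (div_nonneg (hu0 x) (by linarith)) (norm_nonneg _)
  -- `A s` and `B s` integrate `ψ` along a vertical and a horizontal segment at signed distance `s`
  -- from the centre.
  set A : ℝ → ℝ := fun s => ∫ t in (-L)..L, ψ !₂[c 0 + s, c 1 + t] with hA
  set B : ℝ → ℝ := fun s => ∫ t in (-L)..L, ψ !₂[c 0 + t, c 1 + s] with hB
  have hAc : Continuous A := intervalIntegral.continuous_parametric_intervalIntegral_of_continuous'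
    (f := fun s t => ψ !₂[c 0 + s, c 1 + t]) (by unfold Function.uncurry; fun_prop) _ _
  have hBc : Continuous B := intervalIntegral.continuous_parametric_intervalIntegral_of_continuous'
    (f := fun s t => ψ !₂[c 0 + t, c 1 + s]) (by unfold Function.uncurry; fun_prop) _ _
  have hA0 : ∀ s, 0 ≤ A s := fun s =>
    intervalIntegral.integral_nonneg (by linarith) fun t _ => hψ0 _
  have hB0 : ∀ s, 0 ≤ B s := fun s =>
    intervalIntegral.integral_nonneg (by linarith) fun t _ => hψ0 _
  set I := ∫ x in {x | squareDist c x ≤ L}, ψ x with hI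
  have hint : ∫ s in a..L, ((A s + A (-s)) + (B s + B (-s))) ≤ 2 * I := by
    rw [intervalIntegral.integral_add (Continuous.intervalIntegrable (by fun_prop) _ _)
      (Continuous.intervalIntegrable (by fun_prop) _ _)]
    have h1 := integral_add_reflect_le (L := L) hAc hA0 ha
    have h2 := integral_add_reflect_le (L := L) hBc hB0 ha
    have h3 : I = ∫ s in (-L)..L, A s := setIntegral_square c hL hψ
    have h4 : I = ∫ s in (-L)..L, B s := setIntegral_square' c hL hψ
    linarith
  -- Some frame carries at most the average over `s ∈ [a, L]` of the total over all four sides.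
  obtain ⟨s, hs, hF⟩ : ∃ s ∈ Set.Icc a L, (A s + A (-s)) + (B s + B (-s)) ≤ 2 / (L - a) * I := by
    by_contra! hcon
    have h1 : ∫ s in a..L, 2 / (L - a) * I < ∫ s in a..L, ((A s + A (-s)) + (B s + B (-s))) :=
      intervalIntegral.integral_lt_integral_of_continuousOn_of_le_of_exists_lt haL
        continuousOn_const (by fun_prop) (fun s hs => (hcon s ⟨hs.1.le, hs.2⟩).le)
        ⟨L, ⟨haL.le, le_rfl⟩, hcon L ⟨haL.le, le_rfl⟩⟩
    rw [intervalIntegral.integral_const, smul_eq_mul] at h1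
    have : (L - a) * (2 / (L - a) * I) = 2 * I := by
      have : L - a ≠ 0 := by linarith
      field_simp
    linarith
  have hud : ∀ x, HasFDerivAt u (fderiv ℝ u x) x := fun x =>
    (hu.differentiable one_ne_zero x).hasFDerivAt
  have hvert : ∀ q y : ℝ, |y| ≤ L → u !₂[c 0 + q, c 1 + y] ≤ A q := by
    intro q y hy
    have hline : ∀ t : ℝ, HasDerivAt (fun t : ℝ => !₂[c 0 + q, c 1 + t])
        (EuclideanSpace.single 1 (1 : ℝ)) t := by
      intro t
      have h1 : (fun t : ℝ => (!₂[c 0 + q, c 1 + t] : Plane)) =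
          fun t => !₂[c 0 + q, c 1] + t • EuclideanSpace.single 1 (1 : ℝ) := by
        funext t; ext i; fin_cases i <;> simp
      rw [h1]
      simpa using ((hasDerivAt_id t).smul_const (EuclideanSpace.single 1 (1 : ℝ))).const_add
        (!₂[c 0 + q, c 1] : Plane)
    have hd : ∀ t : ℝ, HasDerivAt (fun t : ℝ => u !₂[c 0 + q, c 1 + t])
        ((∇ u !₂[c 0 + q, c 1 + t]) 1) t := by
      intro t
      rw [gradient_apply]
      exact (hud _).comp_hasDerivAt t (hline t)
    have h1 := le_integral_add_abs_deriv hd (by fun_prop) hL hy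
    refine h1.trans (intervalIntegral.integral_mono_on (by linarith)
      (Continuous.intervalIntegrable (by fun_prop) _ _)
      (Continuous.intervalIntegrable (by fun_prop) _ _) fun t _ => ?_)
    exact add_le_add le_rfl (PiLp.norm_apply_le (∇ u !₂[c 0 + q, c 1 + t]) 1)
  have hhor : ∀ q y : ℝ, |y| ≤ L → u !₂[c 0 + y, c 1 + q] ≤ B q := by
    intro q y hy
    have hline : ∀ t : ℝ, HasDerivAt (fun t : ℝ => !₂[c 0 + t, c 1 + q])
        (EuclideanSpace.single 0 (1 : ℝ)) t := by
      intro t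
      have h1 : (fun t : ℝ => (!₂[c 0 + t, c 1 + q] : Plane)) =
          fun t => !₂[c 0, c 1 + q] + t • EuclideanSpace.single 0 (1 : ℝ) := by
        funext t; ext i; fin_cases i <;> simp
      rw [h1]
      simpa using ((hasDerivAt_id t).smul_const (EuclideanSpace.single 0 (1 : ℝ))).const_add
        (!₂[c 0, c 1 + q] : Plane)
    have hd : ∀ t : ℝ, HasDerivAt (fun t : ℝ => u !₂[c 0 + t, c 1 + q])
        ((∇ u !₂[c 0 + t, c 1 + q]) 0) t := by
      intro t
      rw [gradient_apply]
      exact (hud _).comp_hasDerivAt t (hline t)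
    have h1 := le_integral_add_abs_deriv hd (by fun_prop) hL hy
    refine h1.trans (intervalIntegral.integral_mono_on (by linarith)
      (Continuous.intervalIntegrable (by fun_prop) _ _)
      (Continuous.intervalIntegrable (by fun_prop) _ _) fun t _ => ?_)
    exact add_le_add le_rfl (PiLp.norm_apply_le (∇ u !₂[c 0 + t, c 1 + q]) 0)
  refine ⟨s, hs, fun x hx => le_trans ?_ hF⟩
  have h0 : |x 0 - c 0| ≤ L := (le_max_left _ _).trans (hx.le.trans hs.2)
  have h1 : |x 1 - c 1| ≤ L := (le_max_right _ _).trans (hx.le.trans hs.2)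
  have hx' : x = !₂[c 0 + (x 0 - c 0), c 1 + (x 1 - c 1)] := by
    ext i; fin_cases i <;> simp
  have hA1 := hA0 s
  have hA2 := hA0 (-s)
  have hB1 := hB0 s
  have hB2 := hB0 (-s)
  -- A point of the frame lies on one of the four sides, whose integral alone is bounded by the
  -- total.
  rcases max_choice |x 0 - c 0| |x 1 - c 1| with hm | hm
  · have hs' : |x 0 - c 0| = s := hm.symm.trans hx
    have h2 := hvert (x 0 - c 0) _ h1
    rw [← hx'] at h2
    rcases (abs_eq (ha.le.trans hs.1)).1 hs' with h | h <;> rw [h] at h2 <;> linarith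
  · have hs' : |x 1 - c 1| = s := hm.symm.trans hx
    have h2 := hhor (x 1 - c 1) _ h0
    rw [← hx'] at h2
    rcases (abs_eq (ha.le.trans hs.1)).1 hs' with h | h <;> rw [h] at h2 <;> linarith

/-! ### Testing the equation with functions of a smooth approximation -/

theorem integral_mul_sq_le {α : Type*} [MeasurableSpace α] {μ : Measure α} {f g : α → ℝ}
    (hf : MemLp f 2 μ) (hg : MemLp g 2 μ) :
    (∫ x, f x * g x ∂μ) ^ 2 ≤ (∫ x, f x ^ 2 ∂μ) * ∫ x, g x ^ 2 ∂μ := by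
  have hfg : Integrable (fun x => f x * g x) μ := hf.integrable_mul hg
  have key : ∀ t : ℝ, 0 ≤ (∫ x, g x ^ 2 ∂μ) * (t * t) + (2 * ∫ x, f x * g x ∂μ) * t
      + ∫ x, f x ^ 2 ∂μ := by
    intro t
    have h0 : 0 ≤ ∫ x, (f x + t * g x) ^ 2 ∂μ := integral_nonneg fun x => sq_nonneg _
    have h1 : ∀ x, (f x + t * g x) ^ 2 = f x ^ 2 + (2 * t) * (f x * g x) + t ^ 2 * g x ^ 2 :=
      fun x => by ring
    simp only [h1] at h0
    rw [integral_add (f := fun x => f x ^ 2 + (2 * t) * (f x * g x))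
        (hf.integrable_sq.add (hfg.const_mul _)) (hg.integrable_sq.const_mul _),
      integral_add hf.integrable_sq (hfg.const_mul _), integral_const_mul, integral_const_mul] at h0
    linarith
  have := discrim_le_zero key
  unfold discrim at this
  nlinarith

theorem memLp_closedBall_of_continuous {E : Type*} [NormedAddCommGroup E] {f : Plane → E}
    (hf : Continuous f) (x₀ : Plane) (r : ℝ) : MemLp f 2 (volume.restrict (closedBall x₀ r)) := by
  have hc := isCompact_closedBall x₀ r
  obtain ⟨C, hC⟩ := hc.exists_bound_of_continuousOn hf.continuousOn
  have : IsFiniteMeasure (volume.restrict (closedBall x₀ r)) :=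
    ⟨by simpa using hc.measure_lt_top (μ := volume)⟩
  have hm : AEStronglyMeasurable f (volume.restrict (closedBall x₀ r)) :=
    hf.continuousOn.aestronglyMeasurable_of_isCompact hc measurableSet_closedBall
  exact MemLp.of_bound hm C ((ae_restrict_iff' measurableSet_closedBall).2 (.of_forall hC))

theorem gradient_eq_zero_of_notMem_tsupport {φ : Plane → ℝ} {x : Plane} (hx : x ∉ tsupport φ) :
    ∇ φ x = 0 := by
  have : fderiv ℝ φ x = 0 := by
    by_contra h
    exact hx (support_fderiv_subset ℝ h)
  simp [gradient, this]

theorem aestronglyMeasurable_form {μ : Measure Plane} {a : Plane → Matrix (Fin 2) (Fin 2) ℝ}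
    {F H : Plane → Plane} (ha : ∀ i j, AEStronglyMeasurable (fun x => a x i j) μ)
    (hF : AEStronglyMeasurable F μ) (hH : AEStronglyMeasurable H μ) :
    AEStronglyMeasurable (fun x => (a x *ᵥ (F x).ofLp) ⬝ᵥ (H x).ofLp) μ := by
  simp only [mulVec_dotProduct_eq]
  have hFi : ∀ i : Fin 2, AEStronglyMeasurable (fun x => F x i) μ := fun i =>
    (EuclideanSpace.proj (𝕜 := ℝ) i).continuous.comp_aestronglyMeasurable hF
  have hHi : ∀ i : Fin 2, AEStronglyMeasurable (fun x => H x i) μ := fun i =>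
    (EuclideanSpace.proj (𝕜 := ℝ) i).continuous.comp_aestronglyMeasurable hH
  exact ((((ha 0 0).mul (hFi 0)).add ((ha 0 1).mul (hFi 1))).mul (hHi 0)).add
    ((((ha 1 0).mul (hFi 0)).add ((ha 1 1).mul (hFi 1))).mul (hHi 1))

/-- The mollification `w` need not be a subsolution. Splitting `∇w = G + (∇w - G)`, the part with
`G` is nonpositive and the rest is bounded pointwise by `Λ|∇w - G||∇φ|`. -/
theorem integral_form_le_of_subsolution {x₀ : Plane} {R r ν Λ : ℝ} (hr : r < R) (hν : 0 < ν)
    {a : Plane → Matrix (Fin 2) (Fin 2) ℝ} (ha : IsEllipticOn (ball x₀ R) ν Λ a)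
    {G : Plane → Plane} (hG : MemLp G 2 (volume.restrict (ball x₀ R)))
    (hsub : ∀ φ : Plane → ℝ, ContDiff ℝ 1 φ → HasCompactSupport φ → tsupport φ ⊆ ball x₀ R →
      (∀ x, 0 ≤ φ x) → ∫ x in ball x₀ R, (a x *ᵥ (G x).ofLp) ⬝ᵥ (∇ φ x).ofLp ≤ 0)
    {w : Plane → ℝ} (hw : ContDiff ℝ 1 w) {φ : Plane → ℝ} (hφ : ContDiff ℝ 1 φ)
    (hφs : tsupport φ ⊆ closedBall x₀ r) (hφ0 : ∀ x, 0 ≤ φ x) :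
    IntegrableOn (fun x => (a x *ᵥ (∇ w x).ofLp) ⬝ᵥ (∇ φ x).ofLp) (closedBall x₀ r) ∧
    ∫ x in closedBall x₀ r, (a x *ᵥ (∇ w x).ofLp) ⬝ᵥ (∇ φ x).ofLp ≤
      Λ * ∫ x in closedBall x₀ r, ‖∇ w x - G x‖ * ‖∇ φ x‖ := by
  have hDB : closedBall x₀ r ⊆ ball x₀ R := closedBall_subset_ball hr
  have hcs : HasCompactSupport φ :=
    (isCompact_closedBall x₀ r).of_isClosed_subset (isClosed_tsupport φ) hφs
  have h0 := hsub φ hφ hcs (hφs.trans hDB) hφ0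
  have hμ : volume.restrict (closedBall x₀ r) ≤ volume.restrict (ball x₀ R) :=
    Measure.restrict_mono hDB le_rfl
  rw [setIntegral_eq_of_subset_of_forall_sdiff_eq_zero measurableSet_ball hDB (fun x hx => by
    rw [gradient_eq_zero_of_notMem_tsupport fun h => hx.2 (hφs h)]
    simp)] at h0
  have hsymm := ae_mono hμ ha.symm
  have hbd := ae_mono hμ ha.bounds
  have ham : ∀ i j, AEStronglyMeasurable (fun x => a x i j) (volume.restrict (closedBall x₀ r)) :=
    fun i j => (ha.memLp i j).1.mono_measure hμ
  have hGD := hG.mono_measure hμ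
  have hwD := memLp_closedBall_of_continuous (continuous_gradient hw) x₀ r
  have hφD := memLp_closedBall_of_continuous (continuous_gradient hφ) x₀ r
  have hint : ∀ F : Plane → Plane, MemLp F 2 (volume.restrict (closedBall x₀ r)) →
      IntegrableOn (fun x => (a x *ᵥ (F x).ofLp) ⬝ᵥ (∇ φ x).ofLp) (closedBall x₀ r) := by
    intro F hF
    refine Integrable.mono' ((hF.norm.integrable_mul hφD.norm).const_mul Λ)
      (aestronglyMeasurable_form ham hF.1 hφD.1) ?_
    filter_upwards [hsymm, hbd] with x h1 h2
    exact (abs_form_le h1 h2 hν _ _).trans_eq (by simp [mul_assoc])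
  refine ⟨hint _ hwD, ?_⟩
  have hE : Integrable (fun x => ‖∇ w x - G x‖ * ‖∇ φ x‖) (volume.restrict (closedBall x₀ r)) :=
    (hwD.sub hGD).norm.integrable_mul hφD.norm
  calc ∫ x in closedBall x₀ r, (a x *ᵥ (∇ w x).ofLp) ⬝ᵥ (∇ φ x).ofLp
      ≤ ∫ x in closedBall x₀ r, ((a x *ᵥ (G x).ofLp) ⬝ᵥ (∇ φ x).ofLp +
          Λ * (‖∇ w x - G x‖ * ‖∇ φ x‖)) := by
        refine integral_mono_ae (hint _ hwD) ((hint _ hGD).add (hE.const_mul Λ)) ?_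
        filter_upwards [hsymm, hbd] with x h1 h2
        have h3 := (le_abs_self _).trans (abs_form_le h1 h2 hν (∇ w x - G x) (∇ φ x))
        simp only [mulVec_dotProduct_eq, PiLp.sub_apply] at h3 ⊢
        linarith
    _ ≤ _ := by
        rw [integral_add (hint _ hGD) (hE.const_mul Λ), integral_const_mul]
        linarith

/-- The cutoff is the square of `(1 - |x - x₀|²/r²)₊`. Squaring makes it `C¹` and gives `|∇ζ|² ≤
kζ`, as `form_absorb` requires; the explicit formula later gives a lower bound on the inner square.
-/
theorem exists_cutoff (x₀ : Plane) {r : ℝ} (hr : 0 < r) :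
    ∃ ζ : Plane → ℝ, ContDiff ℝ 1 ζ ∧ tsupport ζ ⊆ closedBall x₀ r ∧ (∀ x, 0 ≤ ζ x) ∧
      (∀ x, ζ x ≤ 1) ∧ (∀ x, ‖∇ ζ x‖ ^ 2 ≤ 16 / r ^ 2 * ζ x) ∧
      ∀ x, dist x x₀ ^ 2 ≤ r ^ 2 → ζ x = (1 - dist x x₀ ^ 2 / r ^ 2) ^ 2 := by
  let p : Plane → ℝ := fun x => 1 - ‖x - x₀‖ ^ 2 / r ^ 2
  have hp : ContDiff ℝ 1 p := by
    have : ContDiff ℝ 1 fun x : Plane => ‖x - x₀‖ ^ 2 :=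
      ContDiff.norm_sq ℝ (contDiff_id.sub contDiff_const)
    exact contDiff_const.sub (this.div_const _)
  have hgp : ∀ x, ‖∇ p x‖ = 2 * ‖x - x₀‖ / r ^ 2 := by
    intro x
    have h1 : HasFDerivAt (fun x : Plane => ‖x - x₀‖ ^ 2) (2 • (innerSL ℝ (x - x₀)).comp
        (ContinuousLinearMap.id ℝ Plane)) x := ((hasFDerivAt_id x).sub_const x₀).norm_sq
    have h2 := ((h1.mul_const (r ^ 2)⁻¹).const_sub 1).fderiv
    rw [norm_gradient]
    simp only [p, div_eq_mul_inv]
    rw [h2]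
    rw [norm_neg, norm_smul, ContinuousLinearMap.comp_id, ← Nat.cast_smul_eq_nsmul ℝ, norm_smul,
      innerSL_apply_norm]
    simp only [Nat.cast_ofNat, norm_inv, norm_pow, Real.norm_eq_abs, sq_abs, Nat.abs_ofNat]
    ring
  have hpos : ∀ x, 0 < p x → ‖x - x₀‖ < r := by
    intro x hx
    have h1 : ‖x - x₀‖ ^ 2 < r ^ 2 := by
      have : ‖x - x₀‖ ^ 2 / r ^ 2 < 1 := by simpa [p] using hx
      rwa [div_lt_one (by positivity)] at this
    exact lt_of_pow_lt_pow_left₀ 2 hr.le h1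
  have hp1 : ∀ x, p x ≤ 1 := fun x => by
    have : 0 ≤ ‖x - x₀‖ ^ 2 / r ^ 2 := by positivity
    simp only [p]; linarith
  refine ⟨fun x => (max (p x) 0) ^ 2, contDiff_posPart_sq.comp hp, ?_, fun x => sq_nonneg _, ?_, ?_,
    ?_⟩
  · refine closure_minimal (fun x hx => ?_) isClosed_closedBall
    rw [mem_closedBall, dist_eq_norm]
    by_contra h
    have h1 : p x ≤ 0 := not_lt.1 fun h2 => h (hpos x h2).le
    exact hx (by simp [max_eq_right h1])
  · intro x
    exact pow_le_one₀ (le_max_right _ _) (max_le (hp1 x) zero_le_one)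
  · intro x
    rw [gradient_comp (hasDerivAt_posPart_sq (p x)) (hp.differentiable one_ne_zero x), norm_smul,
      hgp]
    rcases le_or_gt (p x) 0 with h | h
    · simp [max_eq_right h]
    · have h1 := (hpos x h).le
      simp only [max_eq_left h.le]
      rw [mul_pow, Real.norm_eq_abs, sq_abs]
      have h2 : (2 * ‖x - x₀‖ / r ^ 2) ^ 2 ≤ (2 * r / r ^ 2) ^ 2 := by gcongr
      calc (2 * p x) ^ 2 * (2 * ‖x - x₀‖ / r ^ 2) ^ 2 ≤ (2 * p x) ^ 2 * (2 * r / r ^ 2) ^ 2 := by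
            gcongr
        _ = _ := by field_simp; ring
  · intro x hx
    have : 0 ≤ p x := by
      have h1 : ‖x - x₀‖ ^ 2 / r ^ 2 ≤ 1 := by
        rw [div_le_one (by positivity), ← dist_eq_norm]; exact hx
      simp only [p]; linarith
    simp only [max_eq_left this, p, dist_eq_norm]

/-- The error of a smooth approximation `w` of a function with weak gradient `G`. -/
noncomputable def gradError (x₀ : Plane) (R : ℝ) (G : Plane → Plane) (w : Plane → ℝ) : ℝ :=
  ∫ x in closedBall x₀ (9 / 10 * R), ‖∇ w x - G x‖ * (‖∇ w x‖ + 5 / R * |w x|)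

/-- The half diagonal is `√2 · 3/5 < 9/10`. The remaining margin `R/10` is the room for
mollification. -/
theorem squareDist_subset {x₀ : Plane} {R : ℝ} (hR : 0 < R) :
    {x | squareDist x₀ x ≤ 3 / 5 * R} ⊆ closedBall x₀ (9 / 10 * R) := by
  intro x hx
  have h0 : 0 ≤ squareDist x₀ x := le_trans (abs_nonneg _) (le_max_left _ _)
  have h1 := dist_sq_le_squareDist x₀ x
  have h2 : squareDist x₀ x ^ 2 ≤ (3 / 5 * R) ^ 2 := pow_le_pow_left₀ h0 hx 2
  rw [mem_closedBall]
  refine le_of_sq_le_sq ?_ (by positivity)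
  nlinarith [sq_nonneg R]

section subsolution

variable {x₀ : Plane} {R ν Λ : ℝ} (hR : 0 < R) (hν : 0 < ν)
    {a : Plane → Matrix (Fin 2) (Fin 2) ℝ} (ha : IsEllipticOn (ball x₀ R) ν Λ a)
    {G : Plane → Plane} (hG : MemLp G 2 (volume.restrict (ball x₀ R)))
    (hsub : ∀ φ : Plane → ℝ, ContDiff ℝ 1 φ → HasCompactSupport φ → tsupport φ ⊆ ball x₀ R →
      (∀ x, 0 ≤ φ x) → ∫ x in ball x₀ R, (a x *ᵥ (G x).ofLp) ⬝ᵥ (∇ φ x).ofLp ≤ 0)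
    {w : Plane → ℝ} (hw : ContDiff ℝ 1 w)
include hR hν ha hG hsub hw

/-- Caccioppoli's inequality for a smooth approximation of a subsolution. -/
theorem caccioppoli (hΛ : 0 ≤ Λ) {ε : ℝ} (hε : 0 < ε) :
    ν * ∫ x in {x | squareDist x₀ x ≤ 3 / 5 * R}, smoothPosDeriv ε (w x) * ‖∇ w x‖ ^ 2 ≤
      162 * Λ * (25 / (2 * R ^ 2) * (∫ x in closedBall x₀ (9 / 10 * R), (max (w x) 0) ^ 2)
        + gradError x₀ R G w) := by
  set r := 9 / 10 * R with hr
  have hrR : r < R := by linarith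
  have hr0 : 0 < r := by positivity
  obtain ⟨ζ, hζ, hζs, hζ0, hζ1, hζg, hζe⟩ := exists_cutoff x₀ hr0
  have hwd : ∀ x, DifferentiableAt ℝ w x := hw.differentiable one_ne_zero
  have hgw : ContDiff ℝ 1 fun x => smoothPos ε (w x) := (contDiff_smoothPos hε).comp hw
  -- The test function is `ζ · smoothPos ε (w)`. With `r = 9R/10` the cutoff satisfies `16/r² ≤
  -- 25/R²`, which explains the constants `25/R²` and `5/R` below.
  have hφ : ContDiff ℝ 1 fun x => ζ x * smoothPos ε (w x) := hζ.mul hgw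
  have hφs : tsupport (fun x => ζ x * smoothPos ε (w x)) ⊆ closedBall x₀ r :=
    (tsupport_mul_subset_left).trans hζs
  have hgrad : ∀ x, ∇ (fun x => ζ x * smoothPos ε (w x)) x =
      (ζ x * smoothPosDeriv ε (w x)) • ∇ w x + smoothPos ε (w x) • ∇ ζ x := by
    intro x
    rw [gradient_mul (hζ.differentiable one_ne_zero x) (hgw.differentiable one_ne_zero x),
      gradient_comp (hasDerivAt_smoothPos hε (w x)) (hwd x), smul_smul]
  obtain ⟨hint, hle⟩ := integral_form_le_of_subsolution hrR hν ha hG hsub hw hφ hφs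
    fun x => mul_nonneg (hζ0 x) (smoothPos_nonneg _)
  have hwc := hw.continuous
  have hwg := continuous_gradient hw
  have hζc := hζ.continuous
  have hdc := continuous_smoothPosDeriv hε
  have hcI : ∀ f : Plane → ℝ, Continuous f → IntegrableOn f (closedBall x₀ r) := fun f hf =>
    hf.continuousOn.integrableOn_compact (isCompact_closedBall x₀ r)
  have hμ : volume.restrict (closedBall x₀ r) ≤ volume.restrict (ball x₀ R) :=
    Measure.restrict_mono (closedBall_subset_ball hrR) le_rfl
  have hED : MemLp (fun x => ‖∇ w x - G x‖) 2 (volume.restrict (closedBall x₀ r)) :=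
    ((memLp_closedBall_of_continuous hwg x₀ r).sub (hG.mono_measure hμ)).norm
  -- the left-hand side of the tested inequality
  have hlow : ∫ x in closedBall x₀ r, (ν / 2 * (ζ x * smoothPosDeriv ε (w x) * ‖∇ w x‖ ^ 2)
      - 25 / R ^ 2 * Λ / 2 * (max (w x) 0) ^ 2) ≤
      ∫ x in closedBall x₀ r, (a x *ᵥ (∇ w x).ofLp) ⬝ᵥ
        (∇ (fun x => ζ x * smoothPos ε (w x)) x).ofLp := by
    refine integral_mono_ae (hcI _ (by fun_prop)) hint ?_
    filter_upwards [ae_mono hμ ha.symm, ae_mono hμ ha.bounds] with x h1 h2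
    rw [hgrad]
    refine form_absorb h1 h2 hν _ _ (hζ0 x) (smoothPosDeriv_nonneg hε _) (smoothPos_sq_le hε _)
      ((hζg x).trans ?_) (by positivity)
    refine mul_le_mul_of_nonneg_right ?_ (hζ0 x)
    rw [hr, div_le_div_iff₀ (by positivity) (by positivity)]
    nlinarith [sq_nonneg R]
  -- the error term
  have hupp : ∫ x in closedBall x₀ r, ‖∇ w x - G x‖ * ‖∇ (fun x => ζ x * smoothPos ε (w x)) x‖ ≤
      gradError x₀ R G w := by
    refine integral_mono
      (hED.integrable_mul (memLp_closedBall_of_continuous (continuous_gradient hφ) x₀ r).norm)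
      (hED.integrable_mul (memLp_closedBall_of_continuous
        (f := fun x => ‖∇ w x‖ + 5 / R * |w x|) (by fun_prop) x₀ r)) fun x => ?_
    refine mul_le_mul_of_nonneg_left ?_ (norm_nonneg _)
    rw [hgrad]
    refine (norm_add_le _ _).trans (add_le_add ?_ ?_)
    · rw [norm_smul, Real.norm_of_nonneg (mul_nonneg (hζ0 x) (smoothPosDeriv_nonneg hε _))]
      exact mul_le_of_le_one_left (norm_nonneg _)
        (mul_le_one₀ (hζ1 x) (smoothPosDeriv_nonneg hε _) (smoothPosDeriv_le_one hε _))
    · rw [norm_smul, Real.norm_of_nonneg (smoothPos_nonneg _), mul_comm]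
      have h1 : ‖∇ ζ x‖ ≤ 5 / R := by
        refine le_of_sq_le_sq ((hζg x).trans ?_) (by positivity)
        calc 16 / r ^ 2 * ζ x ≤ 16 / r ^ 2 * 1 :=
              mul_le_mul_of_nonneg_left (hζ1 x) (by positivity)
          _ ≤ (5 / R) ^ 2 := by
              rw [mul_one, div_pow, hr, div_le_div_iff₀ (by positivity) (by positivity)]
              nlinarith [sq_nonneg R]
      exact mul_le_mul h1 ((smoothPos_le_posPart hε _).trans (max_le (le_abs_self _)
        (abs_nonneg _))) (smoothPos_nonneg _) (by positivity)
  -- On the square `|x - x₀|²/r² ≤ 0.72/0.81 = 8/9`, so `ζ ≥ 1/81`.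
  have hsq : ∫ x in {x | squareDist x₀ x ≤ 3 / 5 * R}, smoothPosDeriv ε (w x) * ‖∇ w x‖ ^ 2 ≤
      81 * ∫ x in closedBall x₀ r, ζ x * smoothPosDeriv ε (w x) * ‖∇ w x‖ ^ 2 := by
    rw [← integral_const_mul]
    have hQ : MeasurableSet {x | squareDist x₀ x ≤ 3 / 5 * R} :=
      measurableSet_le (continuous_squareDist x₀).measurable measurable_const
    refine le_trans (setIntegral_mono_on ((hcI _ (by fun_prop)).mono_set (squareDist_subset hR))
      ((hcI (fun x => 81 * (ζ x * smoothPosDeriv ε (w x) * ‖∇ w x‖ ^ 2))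
        (by fun_prop)).mono_set (squareDist_subset hR)) hQ fun x hx => ?_)
      (setIntegral_mono_set (hcI _ (by fun_prop)) (.of_forall fun x => ?_)
        (squareDist_subset hR).eventuallyLE)
    · have h0 : 0 ≤ squareDist x₀ x := le_trans (abs_nonneg _) (le_max_left _ _)
      have h1 := dist_sq_le_squareDist x₀ x
      have h2 : squareDist x₀ x ^ 2 ≤ (3 / 5 * R) ^ 2 := pow_le_pow_left₀ h0 hx 2
      have h3 : dist x x₀ ^ 2 ≤ 72 / 100 * R ^ 2 := by nlinarith
      have h4 : dist x x₀ ^ 2 / r ^ 2 ≤ 8 / 9 := by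
        rw [div_le_iff₀ (by positivity), hr]; nlinarith
      have h5 : 1 / 81 ≤ ζ x := by
        rw [hζe x (by rw [hr]; nlinarith [sq_nonneg R])]
        nlinarith
      have h6 : 0 ≤ smoothPosDeriv ε (w x) * ‖∇ w x‖ ^ 2 :=
        mul_nonneg (smoothPosDeriv_nonneg hε _) (sq_nonneg _)
      nlinarith
    · exact mul_nonneg (by norm_num) (mul_nonneg (mul_nonneg (hζ0 x) (smoothPosDeriv_nonneg hε _))
        (sq_nonneg _))
  rw [integral_sub (hcI _ (by fun_prop)) (hcI _ (by fun_prop)), integral_const_mul,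
    integral_const_mul] at hlow
  have h7 := hlow.trans (hle.trans (mul_le_mul_of_nonneg_left hupp hΛ))
  have h8 := mul_le_mul_of_nonneg_left hsq hν.le
  have h9 : 25 / R ^ 2 * Λ / 2 = Λ * (25 / (2 * R ^ 2)) := by field_simp
  rw [h9] at h7
  linarith

end subsolution

/-! ### The maximum principle for smooth approximations -/

/-- The Gagliardo–Nirenberg–Sobolev embedding of `W^{1,1}` into `L²`, where `2` is the exponent
conjugate to the dimension. It lets the maximum principle pass from a small gradient to a small
function. -/
theorem exists_sobolev_const : ∃ C : ℝ, 0 ≤ C ∧ ∀ φ : Plane → ℝ, ContDiff ℝ 1 φ →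
    HasCompactSupport φ → ∫ x, φ x ^ 2 ≤ C * (∫ x, ‖∇ φ x‖) ^ 2 := by
  refine ⟨lintegralPowLePowLIntegralFDerivConst (volume : Measure Plane) 2, NNReal.coe_nonneg _,
    fun φ hφ hc => ?_⟩
  have h2 : ((Module.finrank ℝ Plane : ℕ) : ℝ).HolderConjugate 2 := by
    rw [finrank_euclideanSpace_fin]
    exact_mod_cast Real.HolderConjugate.two_two
  have h := lintegral_pow_le_pow_lintegral_fderiv (volume : Measure Plane) hφ hc h2
  have hgc := continuous_gradient hφ
  have hcg : HasCompactSupport fun x => ‖∇ φ x‖ := by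
    have : (fun x => ‖∇ φ x‖) = fun x => ‖fderiv ℝ φ x‖ := funext (norm_gradient φ)
    rw [this]
    exact (hc.fderiv ℝ).norm
  have hi : Integrable fun x => ‖∇ φ x‖ := hgc.norm.integrable_of_hasCompactSupport hcg
  have hφ2 : Integrable fun x => φ x ^ 2 := by
    have hcont := hφ.continuous
    refine Continuous.integrable_of_hasCompactSupport (by fun_prop) ?_
    exact hc.comp_left (g := fun t : ℝ => t ^ 2) (by simp)
  have e1 : ∫⁻ x, ‖φ x‖ₑ ^ (2 : ℝ) = ENNReal.ofReal (∫ x, φ x ^ 2) := by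
    rw [ofReal_integral_eq_lintegral_ofReal hφ2 (.of_forall fun x => sq_nonneg _)]
    refine lintegral_congr fun x => ?_
    rw [← ofReal_norm, ENNReal.ofReal_rpow_of_nonneg (norm_nonneg _) (by norm_num)]
    simp
  have e2 : ∫⁻ x, ‖fderiv ℝ φ x‖ₑ = ENNReal.ofReal (∫ x, ‖∇ φ x‖) := by
    rw [ofReal_integral_eq_lintegral_ofReal hi (.of_forall fun x => norm_nonneg _)]
    refine lintegral_congr fun x => ?_
    rw [← ofReal_norm, norm_gradient]
  have h0 : 0 ≤ ∫ x, ‖∇ φ x‖ := integral_nonneg fun x => norm_nonneg _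
  rw [e1, e2, ENNReal.ofReal_rpow_of_nonneg h0 (by norm_num), ← ENNReal.ofReal_coe_nnreal,
    ← ENNReal.ofReal_mul (NNReal.coe_nonneg _),
    ENNReal.ofReal_le_ofReal_iff (by positivity)] at h
  simpa using h

/-- Extension by zero of a function that vanishes near the frame of a square. -/
theorem contDiff_square_extension {f : Plane → ℝ} (hf : ContDiff ℝ 1 f) {c : Plane} {s : ℝ}
    (h0 : ∀ x, squareDist c x = s → ∀ᶠ y in nhds x, f y = 0) :
    ContDiff ℝ 1 ({x | squareDist c x < s}.indicator f) ∧
      ∇ ({x | squareDist c x < s}.indicator f) = {x | squareDist c x < s}.indicator (∇ f) := by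
  set F := {x | squareDist c x < s}.indicator f with hF
  have hloc : ∀ x, (squareDist c x < s ∧ F =ᶠ[nhds x] f) ∨
      (¬ squareDist c x < s ∧ F =ᶠ[nhds x] fun _ => 0) := by
    intro x
    rcases lt_trichotomy (squareDist c x) s with h | h | h
    · refine Or.inl ⟨h, ?_⟩
      filter_upwards [(continuous_squareDist c).continuousAt.eventually (gt_mem_nhds h)] with y hy
      exact Set.indicator_of_mem (s := {x | squareDist c x < s}) hy f
    · refine Or.inr ⟨h.not_lt, ?_⟩
      filter_upwards [h0 x h] with y hy
      by_cases hm : y ∈ {x | squareDist c x < s} <;> simp [hF, Set.indicator, hy]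
    · refine Or.inr ⟨h.le.not_gt, ?_⟩
      filter_upwards [(continuous_squareDist c).continuousAt.eventually (lt_mem_nhds h)] with y hy
      exact Set.indicator_of_notMem (s := {x | squareDist c x < s}) (not_lt.2 (le_of_lt hy)) f
  refine ⟨contDiff_iff_contDiffAt.2 fun x => ?_, funext fun x => ?_⟩
  · rcases hloc x with ⟨-, h⟩ | ⟨-, h⟩
    · exact hf.contDiffAt.congr_of_eventuallyEq h
    · exact contDiffAt_const.congr_of_eventuallyEq h
  · rcases hloc x with ⟨hm, h⟩ | ⟨hm, h⟩
    · rw [Set.indicator_of_mem (s := {x | squareDist c x < s}) hm, gradient, gradient,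
        h.fderiv_eq]
    · rw [Set.indicator_of_notMem (s := {x | squareDist c x < s}) hm, gradient, h.fderiv_eq]
      simp

section subsolution

variable {x₀ : Plane} {R ν Λ : ℝ} (hR : 0 < R) (hν : 0 < ν)
    {a : Plane → Matrix (Fin 2) (Fin 2) ℝ} (ha : IsEllipticOn (ball x₀ R) ν Λ a)
    {G : Plane → Plane} (hG : MemLp G 2 (volume.restrict (ball x₀ R)))
    (hsub : ∀ φ : Plane → ℝ, ContDiff ℝ 1 φ → HasCompactSupport φ → tsupport φ ⊆ ball x₀ R →
      (∀ x, 0 ≤ φ x) → ∫ x in ball x₀ R, (a x *ᵥ (G x).ofLp) ⬝ᵥ (∇ φ x).ofLp ≤ 0)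
    {w : Plane → ℝ} (hw : ContDiff ℝ 1 w)
include hR hν ha hG hsub hw

/-- If `w` is below `K` on the frame of a square, then `(w - K)₊` is small in the square. -/
theorem max_principle_of_frame (hΛ : 0 ≤ Λ) {ε : ℝ} (hε : 0 < ε) {C : ℝ} (hC : 0 ≤ C)
    (hsob : ∀ φ : Plane → ℝ, ContDiff ℝ 1 φ → HasCompactSupport φ →
      ∫ x, φ x ^ 2 ≤ C * (∫ x, ‖∇ φ x‖) ^ 2)
    {s K : ℝ} (hs : s ≤ 3 / 5 * R) (hK : ∀ x, squareDist x₀ x = s → w x < K) :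
    ∫ x in {x | squareDist x₀ x < s}, smoothPos ε (w x - K) ^ 2 ≤
      C * volume.real (closedBall x₀ (9 / 10 * R)) * (Λ / ν * gradError x₀ R G w) := by
  set r := 9 / 10 * R with hr
  have hrR : r < R := by linarith
  set S := {x | squareDist x₀ x < s} with hS
  have hSm : MeasurableSet S :=
    measurableSet_lt (continuous_squareDist x₀).measurable measurable_const
  have hSD : S ⊆ closedBall x₀ r := fun x hx => squareDist_subset hR ((le_of_lt hx).trans hs)
  have hwd : ∀ x, DifferentiableAt ℝ w x := hw.differentiable one_ne_zero
  have hwc := hw.continuous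
  have hwg := continuous_gradient hw
  have hdc := continuous_smoothPosDeriv hε
  have hf : ContDiff ℝ 1 fun x => smoothPos ε (w x - K) :=
    (contDiff_smoothPos hε).comp (hw.sub contDiff_const)
  have hfg : ∀ x, ∇ (fun x => smoothPos ε (w x - K)) x = smoothPosDeriv ε (w x - K) • ∇ w x := by
    intro x
    have h1 : HasDerivAt (fun t => smoothPos ε (t - K)) (smoothPosDeriv ε (w x - K)) (w x) :=
      (hasDerivAt_smoothPos hε (w x - K)).comp_sub_const (w x) K
    exact gradient_comp h1 (hwd x)
  -- By continuity `w < K` also near the frame, so the truncation vanishes there and its extension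
  -- by zero is an admissible `C¹` test function.
  obtain ⟨hφ, hφg⟩ := contDiff_square_extension (c := x₀) (s := s) hf fun x hx => by
    filter_upwards [hwc.continuousAt.eventually (gt_mem_nhds (hK x hx))] with y hy
    exact smoothPos_of_nonpos hε _ (by linarith)
  rw [← hS] at hφ hφg
  set φ := S.indicator fun x => smoothPos ε (w x - K) with hφd
  have hφs : tsupport φ ⊆ closedBall x₀ r :=
    closure_minimal (Set.support_indicator_subset.trans hSD) isClosed_closedBall
  have hφc : HasCompactSupport φ :=
    (isCompact_closedBall x₀ r).of_isClosed_subset (isClosed_tsupport φ) hφs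
  have hφgx : ∀ x, ∇ φ x = S.indicator (fun x => smoothPosDeriv ε (w x - K) • ∇ w x) x := by
    intro x
    rw [hφg]
    exact congrFun (congrArg S.indicator (funext hfg)) x
  have hnorm : ∀ x, ‖∇ φ x‖ = S.indicator (fun x => smoothPosDeriv ε (w x - K) * ‖∇ w x‖) x := by
    intro x
    rw [hφgx]
    by_cases hx : x ∈ S
    · simp [hx, norm_smul, abs_of_nonneg (smoothPosDeriv_nonneg hε _)]
    · simp [hx]
  obtain ⟨hint, hle⟩ := integral_form_le_of_subsolution hrR hν ha hG hsub hw hφ hφs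
    (fun x => Set.indicator_nonneg (fun x _ => smoothPos_nonneg _) x)
  have hcI : ∀ f : Plane → ℝ, Continuous f → IntegrableOn f (closedBall x₀ r) := fun f hf =>
    hf.continuousOn.integrableOn_compact (isCompact_closedBall x₀ r)
  have hμ : volume.restrict (closedBall x₀ r) ≤ volume.restrict (ball x₀ R) :=
    Measure.restrict_mono (closedBall_subset_ball hrR) le_rfl
  have hED : MemLp (fun x => ‖∇ w x - G x‖) 2 (volume.restrict (closedBall x₀ r)) :=
    ((memLp_closedBall_of_continuous hwg x₀ r).sub (hG.mono_measure hμ)).norm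
  -- Inside the square `∇φ = g'∇w` with `0 ≤ g' ≤ 1`, hence `a∇w·∇φ ≥ ν g'|∇w|² ≥ ν|∇φ|²`.
  have hlow : ∫ x in closedBall x₀ r, ν * ‖∇ φ x‖ ^ 2 ≤
      ∫ x in closedBall x₀ r, (a x *ᵥ (∇ w x).ofLp) ⬝ᵥ (∇ φ x).ofLp := by
    have hcφ := continuous_gradient hφ
    refine integral_mono_ae (hcI _ (by fun_prop)) hint ?_
    filter_upwards [ae_mono hμ ha.bounds] with x h2
    rw [hnorm, hφgx]
    by_cases hx : x ∈ S
    · simp only [Set.indicator_of_mem hx, WithLp.ofLp_smul, dotProduct_smul, smul_eq_mul]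
      have h3 := smoothPosDeriv_nonneg hε (w x - K)
      have h4 := smoothPosDeriv_le_one hε (w x - K)
      have h5 : 0 ≤ ν * ‖∇ w x‖ ^ 2 := by positivity
      calc ν * (smoothPosDeriv ε (w x - K) * ‖∇ w x‖) ^ 2
          = smoothPosDeriv ε (w x - K) * (smoothPosDeriv ε (w x - K) * (ν * ‖∇ w x‖ ^ 2)) := by
            ring
        _ ≤ smoothPosDeriv ε (w x - K) * (ν * ‖∇ w x‖ ^ 2) :=
            mul_le_mul_of_nonneg_left (mul_le_of_le_one_left h5 h4) h3
        _ ≤ _ := mul_le_mul_of_nonneg_left (h2 _).1 h3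
    · simp [Set.indicator_of_notMem hx]
  have hupp : ∫ x in closedBall x₀ r, ‖∇ w x - G x‖ * ‖∇ φ x‖ ≤ gradError x₀ R G w := by
    refine integral_mono
      (hED.integrable_mul (memLp_closedBall_of_continuous (continuous_gradient hφ) x₀ r).norm)
      (hED.integrable_mul (memLp_closedBall_of_continuous
        (f := fun x => ‖∇ w x‖ + 5 / R * |w x|) (by fun_prop) x₀ r)) fun x => ?_
    refine mul_le_mul_of_nonneg_left ?_ (norm_nonneg _)
    rw [hnorm]
    refine (Set.indicator_le_self' (fun x _ => mul_nonneg (smoothPosDeriv_nonneg hε _)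
      (norm_nonneg _)) x).trans ?_
    exact (mul_le_of_le_one_left (norm_nonneg _) (smoothPosDeriv_le_one hε _)).trans
      (le_add_of_nonneg_right (by positivity))
  have hgrad2 : ∫ x in closedBall x₀ r, ‖∇ φ x‖ ^ 2 ≤ Λ / ν * gradError x₀ R G w := by
    rw [integral_const_mul] at hlow
    have := hlow.trans (hle.trans (mul_le_mul_of_nonneg_left hupp hΛ))
    rw [div_mul_eq_mul_div, le_div_iff₀ hν]
    linarith
  have hgrad1 : (∫ x, ‖∇ φ x‖) ^ 2 ≤
      volume.real (closedBall x₀ r) * ∫ x in closedBall x₀ r, ‖∇ φ x‖ ^ 2 := by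
    have h1 : ∫ x, ‖∇ φ x‖ = ∫ x in closedBall x₀ r, 1 * ‖∇ φ x‖ := by
      simp only [one_mul]
      refine (setIntegral_eq_integral_of_forall_compl_eq_zero fun x hx => ?_).symm
      rw [gradient_eq_zero_of_notMem_tsupport fun h => hx (hφs h), norm_zero]
    rw [h1]
    refine (integral_mul_sq_le (memLp_closedBall_of_continuous continuous_const x₀ r)
      (memLp_closedBall_of_continuous (continuous_gradient hφ) x₀ r).norm).trans_eq ?_
    simp [Measure.real]
  have hL : ∫ x in S, smoothPos ε (w x - K) ^ 2 = ∫ x, φ x ^ 2 := by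
    rw [← integral_indicator hSm]
    congr 1
    funext x
    by_cases hx : x ∈ S <;> simp [hφd, hx]
  rw [hL]
  calc ∫ x, φ x ^ 2 ≤ C * (∫ x, ‖∇ φ x‖) ^ 2 := hsob φ hφ hφc
    _ ≤ C * (volume.real (closedBall x₀ r) * (Λ / ν * gradError x₀ R G w)) :=
        mul_le_mul_of_nonneg_left (hgrad1.trans
          (mul_le_mul_of_nonneg_left hgrad2 measureReal_nonneg)) hC
    _ = _ := by ring

end subsolution

/-! ### The local maximum estimate -/

theorem integral_norm_sq_le_of_lintegral_le {α E : Type*} [MeasurableSpace α] {μ : Measure α}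
    [NormedAddCommGroup E] {f : α → E} (hf : AEStronglyMeasurable f μ) {c : ℝ} (hc : 0 ≤ c)
    (h : ∫⁻ x, ‖f x‖ₑ ^ 2 ∂μ ≤ ENNReal.ofReal c) : ∫ x, ‖f x‖ ^ 2 ∂μ ≤ c := by
  rw [integral_eq_lintegral_of_nonneg_ae (.of_forall fun x => sq_nonneg _)
    (hf.norm.pow 2)]
  refine ENNReal.toReal_le_of_le_ofReal hc (le_of_eq_of_le (lintegral_congr fun x => ?_) h)
  rw [ENNReal.ofReal_pow (norm_nonneg _), ofReal_norm]

/-- By Cauchy–Schwarz `gradError` is at most `‖∇w - G‖` times an `L²` norm that stays bounded along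
the approximation. -/
theorem exists_approx_gradError {x₀ : Plane} {R : ℝ} (hR : 0 < R) {v : Plane → ℝ}
    {G : Plane → Plane} (hv : HasW12Gradient (ball x₀ R) v G) {δ : ℝ} (hδ : 0 < δ) :
    ∃ w : Plane → ℝ, ContDiff ℝ 1 w ∧ ∫ x in closedBall x₀ (9 / 10 * R), (w x - v x) ^ 2 ≤ δ ∧
      gradError x₀ R G w ≤ δ := by
  set D := closedBall x₀ (9 / 10 * R) with hD
  have hrR : 9 / 10 * R < R := by linarith
  have hμ : volume.restrict D ≤ volume.restrict (ball x₀ R) :=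
    Measure.restrict_mono (closedBall_subset_ball hrR) le_rfl
  have hvD := hv.memLp.mono_measure hμ
  have hGD := hv.memLp_grad.mono_measure hμ
  set A := ∫ x in D, ‖G x‖ ^ 2 with hA
  set V := ∫ x in D, v x ^ 2 with hV
  have hA0 : 0 ≤ A := integral_nonneg fun x => sq_nonneg _
  have hV0 : 0 ≤ V := integral_nonneg fun x => sq_nonneg _
  -- `T` bounds `∫(|∇w| + (5/R)|w|)²` uniformly for `η ≤ 1`, via `(p + q + y + z)² ≤ 4(p² + q² + y²
  -- + z²)`; the `8` comes from `4 · 2η`.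
  set T := 8 + 4 * A + 100 / R ^ 2 * (1 + V) with hT
  have hT0 : 0 < T := by positivity
  obtain ⟨η, hη0, hηδ, hη1, hηT⟩ : ∃ η : ℝ, 0 < η ∧ η ≤ δ ∧ η ≤ 1 ∧ 2 * η * T ≤ δ ^ 2 := by
    refine ⟨min (min δ 1) (δ ^ 2 / (2 * T)), by positivity, (min_le_left _ _).trans (min_le_left _ _),
      (min_le_left _ _).trans (min_le_right _ _), ?_⟩
    have := min_le_right (min δ 1) (δ ^ 2 / (2 * T))
    rw [le_div_iff₀ (by positivity)] at this
    linarith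
  obtain ⟨w, hw, h1, h2⟩ := exists_smooth_approx hrR hv (ENNReal.ofReal_pos.2 hη0)
  have hwD := memLp_closedBall_of_continuous hw.continuous x₀ (9 / 10 * R)
  have hgD := memLp_closedBall_of_continuous (continuous_gradient hw) x₀ (9 / 10 * R)
  rw [← ENNReal.ofReal_add hη0.le hη0.le] at h2
  have e1 := integral_norm_sq_le_of_lintegral_le (hwD.sub hvD).1 hη0.le h1
  have e2 := integral_norm_sq_le_of_lintegral_le (hgD.sub hGD).1 (by positivity) h2
  simp only [Pi.sub_apply, Real.norm_eq_abs, sq_abs] at e1 e2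
  refine ⟨w, hw, e1.trans hηδ, ?_⟩
  have hX : MemLp (fun x => ‖∇ w x‖ + 5 / R * |w x|) 2 (volume.restrict D) := by
    have := continuous_gradient hw
    have := hw.continuous
    exact memLp_closedBall_of_continuous (by fun_prop) x₀ _
  have hE := hgD.sub hGD
  have hP := hwD.sub hvD
  have hX2 : ∫ x in D, (‖∇ w x‖ + 5 / R * |w x|) ^ 2 ≤ T := by
    have i1 : Integrable (fun x => ‖∇ w x - G x‖ ^ 2) (volume.restrict D) := hE.norm.integrable_sq
    have i2 : Integrable (fun x => ‖G x‖ ^ 2) (volume.restrict D) := hGD.norm.integrable_sq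
    have i3 : Integrable (fun x => (w x - v x) ^ 2) (volume.restrict D) := hP.integrable_sq
    have i4 : Integrable (fun x => v x ^ 2) (volume.restrict D) := hvD.integrable_sq
    calc ∫ x in D, (‖∇ w x‖ + 5 / R * |w x|) ^ 2
        ≤ ∫ x in D, ((4 * ‖∇ w x - G x‖ ^ 2 + 4 * ‖G x‖ ^ 2) +
            (100 / R ^ 2 * (w x - v x) ^ 2 + 100 / R ^ 2 * v x ^ 2)) := by
          refine integral_mono hX.integrable_sq (((i1.const_mul 4).add (i2.const_mul 4)).add
            ((i3.const_mul _).add (i4.const_mul _))) fun x => ?_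
          have a1 : ‖∇ w x‖ ≤ ‖∇ w x - G x‖ + ‖G x‖ := by
            simpa using norm_add_le (∇ w x - G x) (G x)
          have a2 : |w x| ≤ |w x - v x| + |v x| := by
            simpa using abs_add_le (w x - v x) (v x)
          have a3 : ‖∇ w x‖ + 5 / R * |w x| ≤
              ‖∇ w x - G x‖ + ‖G x‖ + (5 / R * |w x - v x| + 5 / R * |v x|) := by
            rw [← mul_add]; gcongr
          have a4 := pow_le_pow_left₀ (by positivity) a3 2
          refine a4.trans ?_
          have b1 : 100 / R ^ 2 * (w x - v x) ^ 2 = 4 * (5 / R * |w x - v x|) ^ 2 := by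
            rw [mul_pow, sq_abs]; ring
          have b2 : 100 / R ^ 2 * v x ^ 2 = 4 * (5 / R * |v x|) ^ 2 := by
            rw [mul_pow, sq_abs]; ring
          rw [b1, b2]
          generalize ‖∇ w x - G x‖ = p
          generalize ‖G x‖ = q
          generalize 5 / R * |w x - v x| = y
          generalize 5 / R * |v x| = z
          nlinarith [sq_nonneg (p - q), sq_nonneg (y - z), sq_nonneg (p + q - y - z)]
      _ = (4 * (∫ x in D, ‖∇ w x - G x‖ ^ 2) + 4 * A) +
            (100 / R ^ 2 * (∫ x in D, (w x - v x) ^ 2) + 100 / R ^ 2 * V) := by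
          rw [integral_add, integral_add (i1.const_mul 4) (i2.const_mul 4),
            integral_add (i3.const_mul _) (i4.const_mul _)]
          · simp only [integral_const_mul, hA, hV]
          · exact (i1.const_mul 4).add (i2.const_mul 4)
          · exact (i3.const_mul _).add (i4.const_mul _)
      _ ≤ T := by
          have : 100 / R ^ 2 * (∫ x in D, (w x - v x) ^ 2) ≤ 100 / R ^ 2 * 1 :=
            mul_le_mul_of_nonneg_left (e1.trans hη1) (by positivity)
          rw [hT]
          linarith
  refine le_of_sq_le_sq ?_ hδ.le
  calc gradError x₀ R G w ^ 2
      ≤ (∫ x in D, ‖∇ w x - G x‖ ^ 2) * ∫ x in D, (‖∇ w x‖ + 5 / R * |w x|) ^ 2 :=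
        integral_mul_sq_le hE.norm hX
    _ ≤ (η + η) * T := mul_le_mul e2 hX2 (integral_nonneg fun x => sq_nonneg _) (by positivity)
    _ = 2 * η * T := by ring
    _ ≤ δ ^ 2 := hηT

section subsolution

variable {x₀ : Plane} {R ν Λ : ℝ} (hR : 0 < R) (hν : 0 < ν)
    {a : Plane → Matrix (Fin 2) (Fin 2) ℝ} (ha : IsEllipticOn (ball x₀ R) ν Λ a)
    {G : Plane → Plane} (hG : MemLp G 2 (volume.restrict (ball x₀ R)))
    (hsub : ∀ φ : Plane → ℝ, ContDiff ℝ 1 φ → HasCompactSupport φ → tsupport φ ⊆ ball x₀ R →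
      (∀ x, 0 ≤ φ x) → ∫ x in ball x₀ R, (a x *ᵥ (G x).ofLp) ⬝ᵥ (∇ φ x).ofLp ≤ 0)
    {w : Plane → ℝ} (hw : ContDiff ℝ 1 w)
include hR hν ha hG hsub hw

/-- On the frame of some square, a smooth approximation of a subsolution is bounded by its
positive part in `L²`, up to the approximation error. -/
theorem exists_frame_bound_of_subsolution (hΛ : ν ≤ Λ) {ε : ℝ} (hε : 0 < ε) :
    ∃ s ∈ Set.Icc (R / 2) (3 / 5 * R), ∀ x, squareDist x₀ x = s →
      smoothPos ε (w x) ^ 2 ≤ √(Λ / ν) * (40540 / R ^ 2 *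
        (∫ x in closedBall x₀ (9 / 10 * R), (max (w x) 0) ^ 2)
        + 3240 * gradError x₀ R G w) := by
  set L := 3 / 5 * R with hL
  set Q := {x | squareDist x₀ x ≤ L} with hQ
  set D := closedBall x₀ (9 / 10 * R) with hD
  set W := ∫ x in D, (max (w x) 0) ^ 2 with hW
  have hwd : ∀ x, DifferentiableAt ℝ w x := hw.differentiable one_ne_zero
  have hwc := hw.continuous
  have hwg := continuous_gradient hw
  have hdc := continuous_smoothPosDeriv hε
  have hsc := (contDiff_smoothPos hε).continuous
  have hgw : ContDiff ℝ 1 fun x => smoothPos ε (w x) := (contDiff_smoothPos hε).comp hw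
  obtain ⟨s, hs, h⟩ := exists_frame_bound (hgw.pow 2) (fun x => sq_nonneg _) x₀
    (show 0 < R / 2 by positivity) (show R / 2 < L by rw [hL]; linarith)
  refine ⟨s, hs, fun x hx => (h x hx).trans ?_⟩
  have hΛν : 1 ≤ Λ / ν := (one_le_div hν).2 hΛ
  set l := √(Λ / ν) with hl
  have hl1 : 1 ≤ l := Real.one_le_sqrt.2 hΛν
  have hll : l * l = Λ / ν := Real.mul_self_sqrt (by positivity)
  have hcac := caccioppoli hR hν ha hG hsub hw (hν.le.trans hΛ) hε
  set X := ∫ x in Q, smoothPosDeriv ε (w x) * ‖∇ w x‖ ^ 2 with hX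
  set δ := gradError x₀ R G w with hδ
  have hX1 : X ≤ l * l * (2025 / R ^ 2 * W + 162 * δ) := by
    rw [hll, div_mul_eq_mul_div, le_div_iff₀ hν]
    refine (le_of_eq (mul_comm _ _)).trans (hcac.trans_eq ?_)
    ring
  have hDI : ∀ f : Plane → ℝ, Continuous f → IntegrableOn f D := fun f hf =>
    hf.continuousOn.integrableOn_compact (isCompact_closedBall _ _)
  have hQI : ∀ f : Plane → ℝ, Continuous f → IntegrableOn f Q := fun f hf =>
    (hDI f hf).mono_set (squareDist_subset hR)
  have hWQ : ∫ x in Q, (max (w x) 0) ^ 2 ≤ W :=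
    setIntegral_mono_set (hDI _ (by fun_prop)) (.of_forall fun x => sq_nonneg _)
      (squareDist_subset hR).eventuallyLE
  -- The weight `l/R` is the decisive choice: Caccioppoli costs `l²` on the gradient term, so both
  -- terms end up of order `l = √(Λ/ν)`.
  have hgrad : ∀ x, ‖∇ (fun x => smoothPos ε (w x) ^ 2) x‖ ≤
      l / R * (max (w x) 0) ^ 2 + R / l * (smoothPosDeriv ε (w x) * ‖∇ w x‖ ^ 2) := by
    intro x
    have h1 : HasDerivAt (fun t => smoothPos ε t ^ 2)
        (2 * smoothPos ε (w x) * smoothPosDeriv ε (w x)) (w x) := by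
      simpa [Pi.pow_def] using (hasDerivAt_smoothPos hε (w x)).fun_pow 2
    have h2 := smoothPosDeriv_nonneg hε (w x)
    have h3 := smoothPosDeriv_le_one hε (w x)
    have h4 := smoothPos_le_posPart hε (w x)
    have h5 := smoothPos_nonneg (ε := ε) (w x)
    rw [gradient_comp h1 (hwd x), norm_smul, Real.norm_of_nonneg (by positivity)]
    have h6 : smoothPosDeriv ε (w x) * (smoothPosDeriv ε (w x) * ‖∇ w x‖ ^ 2) ≤
        smoothPosDeriv ε (w x) * ‖∇ w x‖ ^ 2 :=
      mul_le_of_le_one_left (by positivity) h3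
    have h7 : 2 * smoothPos ε (w x) * smoothPosDeriv ε (w x) * ‖∇ w x‖ ≤
        2 * max (w x) 0 * (smoothPosDeriv ε (w x) * ‖∇ w x‖) := by
      rw [mul_assoc]; gcongr
    have h8 : 2 * max (w x) 0 * (smoothPosDeriv ε (w x) * ‖∇ w x‖) ≤
        l / R * (max (w x) 0) ^ 2 + R / l * (smoothPosDeriv ε (w x) * ‖∇ w x‖) ^ 2 := by
      have h9 : 0 ≤ R / l * (l / R * max (w x) 0 - smoothPosDeriv ε (w x) * ‖∇ w x‖) ^ 2 := by
        positivity
      refine le_of_sub_nonneg (h9.trans_eq ?_)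
      field_simp
      ring
    refine h7.trans (h8.trans (add_le_add le_rfl (mul_le_mul_of_nonneg_left ?_ (by positivity))))
    calc _ = smoothPosDeriv ε (w x) * (smoothPosDeriv ε (w x) * ‖∇ w x‖ ^ 2) := by ring
      _ ≤ _ := h6
  have hint : ∫ x in Q, (smoothPos ε (w x) ^ 2 / (2 * L) + ‖∇ (fun x => smoothPos ε (w x) ^ 2) x‖) ≤
      2 * (l / R) * W + R / l * X := by
    have hgc := continuous_gradient (hgw.pow 2)
    calc _ ≤ ∫ x in Q, (2 * (l / R) * (max (w x) 0) ^ 2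
          + R / l * (smoothPosDeriv ε (w x) * ‖∇ w x‖ ^ 2)) := by
          refine integral_mono (hQI _ (by fun_prop)) (hQI _ (by fun_prop)) fun x => ?_
          have h1 : smoothPos ε (w x) ^ 2 / (2 * L) ≤ l / R * (max (w x) 0) ^ 2 := by
            rw [hL, div_mul_eq_mul_div (c := (max (w x) 0) ^ 2), div_le_div_iff₀ (by positivity) hR]
            have h2 : smoothPos ε (w x) ^ 2 ≤ (max (w x) 0) ^ 2 :=
              pow_le_pow_left₀ (smoothPos_nonneg _) (smoothPos_le_posPart hε _) 2
            have h3 : 1 * (max (w x) 0) ^ 2 ≤ l * (max (w x) 0) ^ 2 :=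
              mul_le_mul_of_nonneg_right hl1 (sq_nonneg _)
            nlinarith [sq_nonneg (max (w x) 0)]
          have h4 := hgrad x
          dsimp only
          linarith
      _ = 2 * (l / R) * (∫ x in Q, (max (w x) 0) ^ 2) + R / l * X := by
          rw [integral_add (hQI _ (by fun_prop)) (hQI _ (by fun_prop)), integral_const_mul,
            integral_const_mul]
      _ ≤ _ := by gcongr
  -- Here `2/(L - R/2) = 20/R`, whence `20 · (2 + 2025) = 40540` and `20 · 162 = 3240`.
  calc 2 / (L - R / 2) * ∫ x in Q,
        (smoothPos ε (w x) ^ 2 / (2 * L) + ‖∇ (fun x => smoothPos ε (w x) ^ 2) x‖)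
      ≤ 2 / (L - R / 2) * (2 * (l / R) * W + R / l * (l * l * (2025 / R ^ 2 * W + 162 * δ))) := by
        have : 0 < L - R / 2 := by rw [hL]; linarith
        exact mul_le_mul_of_nonneg_left (hint.trans (by gcongr)) (by positivity)
    _ = _ := by
        have : L - R / 2 = R / 10 := by rw [hL]; ring
        rw [this]
        field_simp
        ring

end subsolution

theorem volume_real_ball (x₀ : Plane) {R : ℝ} (hR : 0 < R) :
    volume.real (ball x₀ R) = Real.pi * R ^ 2 := by
  rw [Measure.real, EuclideanSpace.volume_ball_fin_two, ENNReal.toReal_mul, ENNReal.toReal_pow,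
    ENNReal.toReal_ofReal hR.le]
  simp [mul_comm, Real.pi_pos.le]

theorem posPartAvgNorm_sq (x₀ : Plane) {R : ℝ} (hR : 0 < R) (v : Plane → ℝ) :
    posPartAvgNorm (ball x₀ R) v ^ 2 =
      (∫ x in ball x₀ R, (max (v x) 0) ^ 2) / (Real.pi * R ^ 2) := by
  have h0 : 0 ≤ ⨍ x in ball x₀ R, (max (v x) 0) ^ 2 := by
    rw [setAverage_eq]
    exact smul_nonneg (by positivity) (integral_nonneg fun x => sq_nonneg _)
  rw [posPartAvgNorm, ← Real.rpow_natCast, ← Real.rpow_mul h0]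
  norm_num
  rw [setAverage_eq, volume_real_ball x₀ hR, smul_eq_mul, div_eq_inv_mul, mul_inv]

theorem posPartAvgNorm_nonneg (x₀ : Plane) (R : ℝ) (v : Plane → ℝ) :
    0 ≤ posPartAvgNorm (ball x₀ R) v := by
  refine Real.rpow_nonneg ?_ _
  rw [setAverage_eq]
  exact smul_nonneg (by positivity) (integral_nonneg fun x => sq_nonneg _)

/-- For an approximation `w` with error `δ`, the frame bound keeps `w` below `K = M + 3ε` on some
frame. The maximum principle and the Lipschitz bound for `smoothPos` then give `∫ smoothPos ε (v -
K)² ≤ Nδ` on the half ball. The frame may depend on `w` but `N` does not, so `δ → 0` forces the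
integral to vanish. The constant `81080` is twice `40540`, from `w₊² ≤ 2v₊² + 2(w - v)²`. -/
theorem ae_le_of_subsolution {x₀ : Plane} {R ν Λ : ℝ} (hR : 0 < R) (hν : 0 < ν) (hΛ : ν ≤ Λ)
    {a : Plane → Matrix (Fin 2) (Fin 2) ℝ} (ha : IsEllipticOn (ball x₀ R) ν Λ a)
    {v : Plane → ℝ} (hsub : IsSubsolution (ball x₀ R) a v) {M ε : ℝ} (hM : 0 ≤ M) (hε : 0 < ε)
    (hMv : √(Λ / ν) * (81080 / R ^ 2 * ∫ x in ball x₀ R, (max (v x) 0) ^ 2) ≤ M ^ 2) :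
    ∀ᵐ x ∂volume.restrict (ball x₀ (R / 2)), v x ≤ M + 3 * ε := by
  obtain ⟨G, hv, hsub⟩ := hsub
  obtain ⟨C, hC, hsob⟩ := exists_sobolev_const
  set D := closedBall x₀ (9 / 10 * R) with hD
  set K := M + 3 * ε with hK
  set l := √(Λ / ν) with hl
  have hΛν : 1 ≤ Λ / ν := (one_le_div hν).2 hΛ
  have hl1 : 1 ≤ l := Real.one_le_sqrt.2 hΛν
  have hμ : volume.restrict D ≤ volume.restrict (ball x₀ R) :=
    Measure.restrict_mono (closedBall_subset_ball (by linarith)) le_rfl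
  have hvD := hv.memLp.mono_measure hμ
  have hHD : ball x₀ (R / 2) ⊆ D :=
    ball_subset_closedBall.trans (closedBall_subset_closedBall (by linarith))
  have hμ2 : volume.restrict (ball x₀ (R / 2)) ≤ volume.restrict D :=
    Measure.restrict_mono hHD le_rfl
  have hscont := (contDiff_smoothPos hε).continuous
  have hposL : ∀ {μ : Measure Plane} {f : Plane → ℝ}, MemLp f 2 μ →
      Integrable (fun x => (max (f x) 0) ^ 2) μ := fun hf => hf.pos_part.integrable_sq
  set N := 2 * (C * volume.real D * (Λ / ν)) + 2 with hN
  have hN0 : 0 < N := by positivity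
  set P := l * (81080 / R ^ 2 + 3240) with hP
  have hP0 : 0 < P := by positivity
  -- the truncation of `v` at height `K` is small in the half ball
  have key : ∀ δ : ℝ, 0 < δ → P * δ ≤ ε ^ 2 →
      ∫ x in ball x₀ (R / 2), smoothPos ε (v x - K) ^ 2 ≤ N * δ := by
    intro δ hδ hPδ
    obtain ⟨w, hw, hwv, hgE⟩ := exists_approx_gradError hR hv hδ
    have hwD := memLp_closedBall_of_continuous hw.continuous x₀ (9 / 10 * R)
    obtain ⟨s, hs, hfr⟩ := exists_frame_bound_of_subsolution hR hν ha hv.memLp_grad hsub hw hΛ hε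
    have hdiff : Integrable (fun x => (w x - v x) ^ 2) (volume.restrict D) :=
      (hwD.sub hvD).integrable_sq
    have hWV : ∫ x in D, (max (w x) 0) ^ 2 ≤
        2 * (∫ x in ball x₀ R, (max (v x) 0) ^ 2) + 2 * δ := by
      calc ∫ x in D, (max (w x) 0) ^ 2
          ≤ ∫ x in D, (2 * (max (v x) 0) ^ 2 + 2 * (w x - v x) ^ 2) := by
            refine integral_mono (hposL hwD)
              (((hposL hvD).const_mul 2).add (hdiff.const_mul 2)) fun x => ?_
            have h1 : max (w x) 0 ≤ max (v x) 0 + |w x - v x| :=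
              max_le (by linarith [le_max_left (v x) 0, le_abs_self (w x - v x)])
                (by positivity)
            have h2 := pow_le_pow_left₀ (le_max_right _ _) h1 2
            have h3 := sq_abs (w x - v x)
            dsimp only
            nlinarith [sq_nonneg (max (v x) 0 - |w x - v x|)]
        _ = 2 * (∫ x in D, (max (v x) 0) ^ 2) + 2 * ∫ x in D, (w x - v x) ^ 2 := by
            rw [integral_add ((hposL hvD).const_mul 2) (hdiff.const_mul 2), integral_const_mul,
              integral_const_mul]
        _ ≤ _ := by
            have : ∫ x in D, (max (v x) 0) ^ 2 ≤ ∫ x in ball x₀ R, (max (v x) 0) ^ 2 :=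
              integral_mono_measure hμ (.of_forall fun x => sq_nonneg _) (hposL hv.memLp)
            linarith
    have hfrK : ∀ x, squareDist x₀ x = s → w x < K := by
      intro x hx
      -- One `ε` absorbs the mollification error, a second is lost in `t - ε ≤ smoothPos ε t`, and
      -- the third makes `w < K` strict.
      have h1 : smoothPos ε (w x) ^ 2 ≤ (M + ε) ^ 2 := by
        refine (hfr x hx).trans ?_
        have h2 : 40540 / R ^ 2 * (∫ x in D, (max (w x) 0) ^ 2) ≤
            40540 / R ^ 2 * (2 * (∫ x in ball x₀ R, (max (v x) 0) ^ 2) + 2 * δ) :=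
          mul_le_mul_of_nonneg_left hWV (by positivity)
        calc _ ≤ l * (40540 / R ^ 2 * (2 * (∫ x in ball x₀ R, (max (v x) 0) ^ 2) + 2 * δ)
              + 3240 * δ) := by gcongr
          _ = l * (81080 / R ^ 2 * ∫ x in ball x₀ R, (max (v x) 0) ^ 2) + P * δ := by
              rw [hP]; ring
          _ ≤ M ^ 2 + ε ^ 2 := add_le_add hMv hPδ
          _ ≤ (M + ε) ^ 2 := by nlinarith [mul_nonneg hM hε.le]
      have h2 := le_of_sq_le_sq h1 (by positivity)
      have h3 := sub_le_smoothPos (ε := ε) (w x)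
      linarith
    have hmax := max_principle_of_frame hR hν ha hv.memLp_grad hsub hw (hν.le.trans hΛ) hε hC
      hsob hs.2 hfrK
    have hHs : ball x₀ (R / 2) ⊆ {x | squareDist x₀ x < s} := fun x hx =>
      lt_of_lt_of_le ((squareDist_le_dist x₀ x).trans_lt hx) hs.1
    have hwc := hw.continuous
    have hSI : IntegrableOn (fun x => smoothPos ε (w x - K) ^ 2) {x | squareDist x₀ x < s} :=
      (Continuous.continuousOn (by fun_prop)).integrableOn_compact (isCompact_closedBall x₀
        (9 / 10 * R)) |>.mono_set fun x hx => squareDist_subset hR ((le_of_lt hx).trans hs.2)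
    have hvm : AEStronglyMeasurable (fun x => smoothPos ε (v x - K) ^ 2) (volume.restrict D) :=
      (hscont.comp_aestronglyMeasurable (hvD.1.sub aestronglyMeasurable_const)).pow 2
    have hpt : ∀ x, smoothPos ε (v x - K) ^ 2 ≤
        2 * smoothPos ε (w x - K) ^ 2 + 2 * (w x - v x) ^ 2 := by
      intro x
      have h1 := abs_smoothPos_sub_le hε (v x - K) (w x - K)
      have h2 : |v x - K - (w x - K)| = |w x - v x| := by
        rw [abs_sub_comm]; congr 1; ring
      rw [h2] at h1
      have h3 := (sq_le_sq.2 h1)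
      nlinarith [sq_nonneg (smoothPos ε (v x - K) - 2 * smoothPos ε (w x - K))]
    have hSI' := hSI.mono_set hHs
    have hdiff' := hdiff.mono_measure hμ2
    calc ∫ x in ball x₀ (R / 2), smoothPos ε (v x - K) ^ 2
        ≤ ∫ x in ball x₀ (R / 2), (2 * smoothPos ε (w x - K) ^ 2 + 2 * (w x - v x) ^ 2) :=
          integral_mono_of_nonneg (.of_forall fun x => sq_nonneg _)
            ((hSI'.const_mul 2).add (hdiff'.const_mul 2)) (.of_forall hpt)
      _ = 2 * (∫ x in ball x₀ (R / 2), smoothPos ε (w x - K) ^ 2) +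
            2 * ∫ x in ball x₀ (R / 2), (w x - v x) ^ 2 := by
          rw [integral_add (hSI'.const_mul 2) (hdiff'.const_mul 2), integral_const_mul,
            integral_const_mul]
      _ ≤ 2 * (C * volume.real D * (Λ / ν * δ)) + 2 * δ := by
          have h1 : ∫ x in ball x₀ (R / 2), smoothPos ε (w x - K) ^ 2 ≤
              C * volume.real D * (Λ / ν * δ) :=
            (setIntegral_mono_set hSI (.of_forall fun x => sq_nonneg _)
              hHs.eventuallyLE).trans (hmax.trans (by gcongr))
          have h2 : ∫ x in ball x₀ (R / 2), (w x - v x) ^ 2 ≤ δ :=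
            (integral_mono_measure hμ2 (.of_forall fun x => sq_nonneg _) hdiff).trans hwv
          linarith
      _ = N * δ := by rw [hN]; ring
  have hvH := hvD.mono_measure hμ2
  have hint : Integrable (fun x => smoothPos ε (v x - K) ^ 2)
      (volume.restrict (ball x₀ (R / 2))) := by
    have hfin : IsFiniteMeasure (volume.restrict (ball x₀ (R / 2))) :=
      ⟨by simpa using measure_ball_lt_top (μ := volume) (x := x₀) (r := R / 2)⟩
    have h1 : MemLp (fun x => v x - K) 2 (volume.restrict (ball x₀ (R / 2))) :=
      hvH.sub (memLp_const K)
    refine (h1.of_le (hscont.comp_aestronglyMeasurable h1.1) (.of_forall fun x => ?_)).integrable_sq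
    rw [Real.norm_of_nonneg (smoothPos_nonneg _)]
    exact (smoothPos_le_posPart hε _).trans (max_le (Real.le_norm_self _) (norm_nonneg _))
  have hzero : ∫ x in ball x₀ (R / 2), smoothPos ε (v x - K) ^ 2 = 0 := by
    refine le_antisymm (le_of_forall_pos_le_add fun τ hτ => ?_)
      (integral_nonneg fun x => sq_nonneg _)
    have hmin : 0 < min (τ / N) (ε ^ 2 / P) := by positivity
    refine (key _ hmin ?_).trans ?_
    · have := min_le_right (τ / N) (ε ^ 2 / P)
      rw [le_div_iff₀ hP0] at this
      linarith
    · have := min_le_left (τ / N) (ε ^ 2 / P)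
      rw [le_div_iff₀ hN0] at this
      linarith
  rw [integral_eq_zero_iff_of_nonneg (fun x => sq_nonneg _) hint] at hzero
  filter_upwards [hzero] with x hx
  by_contra! hlt
  have h1 := smoothPos_pos (ε := ε) (v x - K) (by linarith)
  exact (pow_pos h1 2).ne' hx

theorem localMaxEstimate_quarter (x₀ : Plane) {R : ℝ} (hR : 0 < R) :
    LocalMaxEstimate x₀ R 700 (1 / 4) := by
  intro ν Λ hν hΛ a ha v _ hsub
  set p := posPartAvgNorm (ball x₀ R) v with hp
  have hp0 : 0 ≤ p := posPartAvgNorm_nonneg x₀ R v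
  have hΛν : 0 < Λ / ν := div_pos (hν.trans_le hΛ) hν
  set M := 700 * (Λ / ν) ^ (1 / 4 : ℝ) * p with hM
  have hM0 : 0 ≤ M := by positivity
  have hMv : √(Λ / ν) * (81080 / R ^ 2 * ∫ x in ball x₀ R, (max (v x) 0) ^ 2) ≤ M ^ 2 := by
    have h1 := posPartAvgNorm_sq x₀ hR v
    rw [← hp] at h1
    have h2 : ((Λ / ν) ^ (1 / 4 : ℝ)) ^ 2 = √(Λ / ν) := by
      rw [← Real.rpow_natCast, ← Real.rpow_mul hΛν.le, Real.sqrt_eq_rpow]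
      norm_num
    have h3 : ∫ x in ball x₀ R, (max (v x) 0) ^ 2 = Real.pi * R ^ 2 * p ^ 2 := by
      rw [h1]
      have := Real.pi_pos
      field_simp
    rw [hM, mul_pow, mul_pow, h2, h3]
    have h4 : 81080 / R ^ 2 * (Real.pi * R ^ 2 * p ^ 2) = 81080 * Real.pi * p ^ 2 := by
      field_simp
    rw [h4]
    -- `81080 · 4 = 324320 ≤ 490000 = 700²`; this fixes the universal constant.
    have h5 : 81080 * Real.pi * p ^ 2 ≤ 700 ^ 2 * p ^ 2 := by
      gcongr
      linarith [Real.pi_le_four]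
    calc √(Λ / ν) * (81080 * Real.pi * p ^ 2) ≤ √(Λ / ν) * (700 ^ 2 * p ^ 2) := by gcongr
      _ = _ := by ring
  have hle : ∀ᵐ x ∂volume.restrict (ball x₀ (R / 2)), v x ≤ M := by
    have h1 : ∀ n : ℕ, ∀ᵐ x ∂volume.restrict (ball x₀ (R / 2)), v x ≤ M + 3 * (1 / ((n : ℝ) + 1)) :=
      fun n => ae_le_of_subsolution hR hν hΛ ha hsub hM0 (by positivity) hMv
    filter_upwards [ae_all_iff.2 h1] with x hx
    have h2 : Filter.Tendsto (fun n : ℕ => M + 3 * (1 / ((n : ℝ) + 1))) Filter.atTop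
        (nhds (M + 3 * 0)) := (tendsto_one_div_add_atTop_nhds_zero_nat.const_mul 3).const_add M
    simpa using ge_of_tendsto' h2 hx
  refine essSup_le_of_ae_le _ ?_
  filter_upwards [hle] with x hx
  exact EReal.coe_le_coe_iff.2 hx

/-! ### Optimality of the exponent -/

theorem integral_mul_gradient {f φ : Plane → ℝ} (hf : ContDiff ℝ 1 f) (hφ : ContDiff ℝ 1 φ)
    (hc : HasCompactSupport φ) (i : Fin 2) :
    Integrable (fun x => f x * (∇ φ x) i) ∧
      ∫ x, f x * (∇ φ x) i = - ∫ x, φ x * (∇ f x) i := by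
  have hfc := hf.continuous
  have hφc := hφ.continuous
  have hfg := continuous_gradient hf
  have hφg := continuous_gradient hφ
  have hcg : HasCompactSupport fun x => (∇ φ x) i := by
    refine hc.mono' fun x hx => ?_
    by_contra h
    exact hx (by simp [gradient_eq_zero_of_notMem_tsupport h])
  have i1 : Integrable fun x => f x * (∇ φ x) i :=
    Continuous.integrable_of_hasCompactSupport (by fun_prop) hcg.mul_left
  have i2 : Integrable fun x => (∇ f x) i * φ x :=
    Continuous.integrable_of_hasCompactSupport (by fun_prop) hc.mul_left
  have i3 : Integrable fun x => f x * φ x :=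
    Continuous.integrable_of_hasCompactSupport (by fun_prop) hc.mul_left
  refine ⟨i1, ?_⟩
  simp only [gradient_apply] at i1 i2 ⊢
  rw [integral_mul_fderiv_eq_neg_fderiv_mul_of_integrable i2 i1 i3
    (fun x _ => hf.differentiable one_ne_zero x) fun x _ => hφ.differentiable one_ne_zero x]
  simp only [mul_comm]

theorem setIntegral_eq_integral_of_gradient {φ : Plane → ℝ} {B : Set Plane} (hφ : tsupport φ ⊆ B)
    {F : Plane → ℝ} (hF : ∀ x, ∇ φ x = 0 → F x = 0) : ∫ x in B, F x = ∫ x, F x :=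
  setIntegral_eq_integral_of_forall_compl_eq_zero fun _ hx =>
    hF _ (gradient_eq_zero_of_notMem_tsupport fun h => hx (hφ h))

theorem hasW12Gradient_of_contDiff {v : Plane → ℝ} (hv : ContDiff ℝ 1 v) (x₀ : Plane) (R : ℝ) :
    HasW12Gradient (ball x₀ R) v (∇ v) where
  memLp := (memLp_closedBall_of_continuous hv.continuous x₀ R).mono_measure
    (Measure.restrict_mono ball_subset_closedBall le_rfl)
  memLp_grad := (memLp_closedBall_of_continuous (continuous_gradient hv) x₀ R).mono_measure
    (Measure.restrict_mono ball_subset_closedBall le_rfl)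
  integral_eq φ hφ hc hs i := by
    rw [setIntegral_eq_integral_of_gradient hs fun x hx => by simp [hx],
      (integral_mul_gradient hv (hφ.of_le (by simp)) hc i).2,
      setIntegral_eq_integral_of_forall_compl_eq_zero fun x hx => by
        rw [image_eq_zero_of_notMem_tsupport fun h => hx (hs h), zero_mul]]

/-- The function `1 + y₂² - Λ y₁²` in the coordinates `y = (x - x₀) / R`. -/
noncomputable def saddle (x₀ : Plane) (R Λ : ℝ) (x : Plane) : ℝ :=
  1 + ((x 1 - x₀ 1) / R) ^ 2 - Λ * ((x 0 - x₀ 0) / R) ^ 2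

section saddle

variable (x₀ : Plane) {R Λ : ℝ}

theorem contDiff_coord_sub (i : Fin 2) : ContDiff ℝ 1 fun x : Plane => x i - x₀ i :=
  (EuclideanSpace.proj (𝕜 := ℝ) i).contDiff.sub contDiff_const

theorem hasFDerivAt_coord_sub (i : Fin 2) (x : Plane) :
    HasFDerivAt (fun x : Plane => x i - x₀ i) (EuclideanSpace.proj (𝕜 := ℝ) i : Plane →L[ℝ] ℝ) x :=
  (EuclideanSpace.proj (𝕜 := ℝ) i : Plane →L[ℝ] ℝ).hasFDerivAt.sub_const _

variable (R Λ) in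
theorem contDiff_saddle : ContDiff ℝ 1 (saddle x₀ R Λ) :=
  (contDiff_const.add (((contDiff_coord_sub x₀ 1).div_const R).pow 2)).sub
    (contDiff_const.mul (((contDiff_coord_sub x₀ 0).div_const R).pow 2))

theorem gradient_saddle (x : Plane) :
    (∇ (saddle x₀ R Λ) x) 0 = -(2 * Λ / R ^ 2) * (x 0 - x₀ 0) ∧
      (∇ (saddle x₀ R Λ) x) 1 = 2 / R ^ 2 * (x 1 - x₀ 1) := by
  have h1 := ((hasFDerivAt_coord_sub x₀ 1 x).mul_const R⁻¹).pow 2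
  have h0 := ((hasFDerivAt_coord_sub x₀ 0 x).mul_const R⁻¹).pow 2
  have h : HasFDerivAt (saddle x₀ R Λ) _ x := (h1.const_add 1).sub (h0.const_mul Λ)
  constructor
  · rw [gradient_apply, h.fderiv]
    simp
    ring
  · rw [gradient_apply, h.fderiv]
    simp
    ring

theorem isEllipticOn_diagonal (B : Set Plane) (hΛ : 1 ≤ Λ) :
    IsEllipticOn B 1 Λ fun _ => Matrix.diagonal ![1, Λ] where
  memLp i j := memLp_top_const _
  symm := .of_forall fun _ => Matrix.isSymm_diagonal _
  bounds := .of_forall fun _ z => by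
    have h : (Matrix.diagonal ![1, Λ] *ᵥ z.ofLp) ⬝ᵥ z.ofLp = z 0 ^ 2 + Λ * z 1 ^ 2 := by
      rw [mulVec_dotProduct_eq]
      simp
      ring
    rw [h, norm_sq_eq]
    constructor <;> nlinarith [sq_nonneg (z 0), sq_nonneg (z 1)]

/-- The flux is `(2Λ/R²)(-(x₁ - x₀₁), x₂ - x₀₂)`, which is divergence free: both components
integrate by parts to the same multiple of `∫φ`, with opposite signs. The function is thus a
solution, so the sign of `φ` plays no role. -/
theorem isSubsolution_saddle :
    IsSubsolution (ball x₀ R) (fun _ => Matrix.diagonal ![1, Λ]) (saddle x₀ R Λ) := by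
  refine ⟨∇ (saddle x₀ R Λ), hasW12Gradient_of_contDiff (contDiff_saddle x₀ R Λ) x₀ R,
    fun φ hφ hc hs _ => le_of_eq ?_⟩
  rw [setIntegral_eq_integral_of_gradient hs fun x hx => by simp [hx]]
  obtain ⟨i0, e0⟩ := integral_mul_gradient (contDiff_coord_sub x₀ 0) hφ hc 0
  obtain ⟨i1, e1⟩ := integral_mul_gradient (contDiff_coord_sub x₀ 1) hφ hc 1
  have hg : ∀ (i : Fin 2) (x : Plane), (∇ (fun x : Plane => x i - x₀ i) x) i = 1 := by
    intro i x
    rw [gradient_apply, (hasFDerivAt_coord_sub x₀ i x).fderiv]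
    simp
  simp only [hg, mul_one] at e0 e1
  have h : ∀ x, (Matrix.diagonal ![1, Λ] *ᵥ (∇ (saddle x₀ R Λ) x).ofLp) ⬝ᵥ (∇ φ x).ofLp =
      -(2 * Λ / R ^ 2) * ((x 0 - x₀ 0) * (∇ φ x) 0)
        + 2 * Λ / R ^ 2 * ((x 1 - x₀ 1) * (∇ φ x) 1) := by
    intro x
    rw [mulVec_dotProduct_eq, (gradient_saddle x₀ x).1, (gradient_saddle x₀ x).2]
    simp
    ring
  simp only [h]
  rw [integral_add (i0.const_mul _) (i1.const_mul _), integral_const_mul, integral_const_mul, e0,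
    e1]
  ring

theorem saddle_center : saddle x₀ R Λ x₀ = 1 := by simp [saddle]

/-- The value at the centre is `1`; by continuity any smaller level is exceeded on a nonempty open
set, which has positive measure. -/
theorem one_le_supOn_saddle (hR : 0 < R) : 1 ≤ supOn (ball x₀ (R / 2)) (saddle x₀ R Λ) := by
  by_contra! hlt
  have hae := ae_le_essSup (μ := volume.restrict (ball x₀ (R / 2)))
    (f := fun x => (saddle x₀ R Λ x : EReal))
  have hopen : IsOpen {x | supOn (ball x₀ (R / 2)) (saddle x₀ R Λ) < (saddle x₀ R Λ x : EReal)} :=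
    isOpen_lt continuous_const
      (continuous_coe_real_ereal.comp (contDiff_saddle x₀ R Λ).continuous)
  have hpos : 0 < volume ({x | supOn (ball x₀ (R / 2)) (saddle x₀ R Λ) < (saddle x₀ R Λ x : EReal)}
      ∩ ball x₀ (R / 2)) :=
    (hopen.inter isOpen_ball).measure_pos volume
      ⟨x₀, by simpa [saddle_center] using hlt, mem_ball_self (by positivity)⟩
  rw [← Measure.restrict_apply hopen.measurableSet] at hpos
  exact hpos.ne' (by simpa only [not_le] using (ae_iff (p := fun x => (saddle x₀ R Λ x : EReal) ≤
    supOn (ball x₀ (R / 2)) (saddle x₀ R Λ))).1 hae)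

theorem posPartAvgNorm_saddle_pos (hR : 0 < R) :
    0 < posPartAvgNorm (ball x₀ R) (saddle x₀ R Λ) := by
  refine (posPartAvgNorm_nonneg x₀ R _).lt_of_ne' fun h0 => ?_
  have h1 := posPartAvgNorm_sq x₀ hR (saddle x₀ R Λ)
  have hc := (contDiff_saddle x₀ R Λ).continuous
  have hint : Integrable (fun x => (max (saddle x₀ R Λ x) 0) ^ 2) (volume.restrict (ball x₀ R)) :=
    (hasW12Gradient_of_contDiff (contDiff_saddle x₀ R Λ) x₀ R).memLp.pos_part.integrable_sq
  have h2 : 0 < ∫ x in ball x₀ R, (max (saddle x₀ R Λ x) 0) ^ 2 := by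
    rw [integral_pos_iff_support_of_nonneg (fun x => sq_nonneg _) hint]
    have hopen : IsOpen (Function.support fun x => (max (saddle x₀ R Λ x) 0) ^ 2) :=
      Continuous.isOpen_support (by fun_prop)
    rw [Measure.restrict_apply hopen.measurableSet]
    exact (hopen.inter isOpen_ball).measure_pos volume
      ⟨x₀, by simp [saddle_center], mem_ball_self hR⟩
  rw [h0] at h1
  have : 0 < (∫ x in ball x₀ R, (max (saddle x₀ R Λ x) 0) ^ 2) / (Real.pi * R ^ 2) := by positivity
  simp only [ne_eq, OfNat.ofNat_ne_zero, not_false_eq_true, zero_pow] at h1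
  exact this.ne h1

theorem volume_box (a b : ℝ) (ha : 0 ≤ a) (hb : 0 ≤ b) :
    volume.real {x : Plane | |x 0 - x₀ 0| ≤ a ∧ |x 1 - x₀ 1| ≤ b} = 4 * a * b ∧
      volume {x : Plane | |x 0 - x₀ 0| ≤ a ∧ |x 1 - x₀ 1| ≤ b} ≠ ⊤ ∧
      MeasurableSet {x : Plane | |x 0 - x₀ 0| ≤ a ∧ |x 1 - x₀ 1| ≤ b} := by
  have hset : {x : Plane | |x 0 - x₀ 0| ≤ a ∧ |x 1 - x₀ 1| ≤ b} =
      (WithLp.ofLp : Plane → Fin 2 → ℝ) ⁻¹'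
        Set.pi Set.univ fun i => Set.Icc (x₀ i - ![a, b] i) (x₀ i + ![a, b] i) := by
    ext x
    simp only [Set.mem_ofPred_eq, Set.mem_preimage, Set.mem_pi, Set.mem_univ, true_imp_iff,
      Fin.forall_fin_two, Set.mem_Icc, abs_le]
    simp only [Matrix.cons_val_zero, Matrix.cons_val_one]
    constructor
    · rintro ⟨⟨h1, h2⟩, h3, h4⟩
      exact ⟨⟨by linarith, by linarith⟩, by linarith, by linarith⟩
    · rintro ⟨⟨h1, h2⟩, h3, h4⟩
      exact ⟨⟨by linarith, by linarith⟩, by linarith, by linarith⟩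
  have hm : MeasurableSet (Set.pi Set.univ fun i : Fin 2 =>
      Set.Icc (x₀ i - ![a, b] i) (x₀ i + ![a, b] i)) := MeasurableSet.univ_pi fun i => measurableSet_Icc
  have hvol : volume {x : Plane | |x 0 - x₀ 0| ≤ a ∧ |x 1 - x₀ 1| ≤ b} =
      ENNReal.ofReal (2 * a) * ENNReal.ofReal (2 * b) := by
    rw [hset, (PiLp.volume_preserving_ofLp (Fin 2)).measure_preimage hm.nullMeasurableSet,
      volume_pi_pi, Fin.prod_univ_two]
    simp only [Real.volume_Icc, Matrix.cons_val_zero, Matrix.cons_val_one]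
    congr 2 <;> ring
  refine ⟨?_, ?_, ?_⟩
  · rw [Measure.real, hvol, ENNReal.toReal_mul, ENNReal.toReal_ofReal (by positivity),
      ENNReal.toReal_ofReal (by positivity)]
    ring
  · rw [hvol]
    exact ENNReal.mul_ne_top ENNReal.ofReal_ne_top ENNReal.ofReal_ne_top
  · rw [hset]
    exact (PiLp.volume_preserving_ofLp (Fin 2)).measurable hm

/-- With `y = (x - x₀)/R`, positivity forces `Λy₁² < 1 + y₂² ≤ 2`, hence `|y₁| ≤ (3/2)/√Λ`, and
there the function is at most `2`. The square integral is at most `4` times the area of this box,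
namely `24R²/√Λ`, and `24/π ≤ 9 = 3²`. -/
theorem posPartAvgNorm_saddle_le (hR : 0 < R) (hΛ : 1 ≤ Λ) :
    posPartAvgNorm (ball x₀ R) (saddle x₀ R Λ) ≤ 3 * Λ ^ (-(1 / 4) : ℝ) := by
  have hΛ0 : 0 < Λ := by linarith
  have hsq : 0 < √Λ := Real.sqrt_pos.2 hΛ0
  set S := {x : Plane | |x 0 - x₀ 0| ≤ 3 / 2 * R / √Λ ∧ |x 1 - x₀ 1| ≤ R} with hS
  obtain ⟨hvol, hfin, hm⟩ := volume_box x₀ (3 / 2 * R / √Λ) R (by positivity) hR.le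
  rw [← hS] at hvol hfin hm
  have hint : IntegrableOn (fun _ : Plane => (4 : ℝ)) S := integrableOn_const hfin
  have hpt : ∀ x ∈ ball x₀ R, (max (saddle x₀ R Λ x) 0) ^ 2 ≤ S.indicator (fun _ => 4) x := by
    intro x hx
    have hx1 : |x 1 - x₀ 1| ≤ R := by
      rw [mem_ball, dist_eq_norm] at hx
      exact (PiLp.norm_apply_le (x - x₀) 1).trans hx.le
    have hy : ((x 1 - x₀ 1) / R) ^ 2 ≤ 1 := by
      rw [div_pow, div_le_one (by positivity), ← sq_abs]
      exact pow_le_pow_left₀ (abs_nonneg _) hx1 2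
    rcases le_or_gt (saddle x₀ R Λ x) 0 with h | h
    · rw [max_eq_right h]
      simpa using Set.indicator_nonneg (s := S) (f := fun _ => (4 : ℝ)) (by norm_num) x
    · have h2 : Λ * ((x 0 - x₀ 0) / R) ^ 2 < 2 := by unfold saddle at h; linarith
      have h3 : |x 0 - x₀ 0| ≤ 3 / 2 * R / √Λ := by
        refine abs_le_of_sq_le_sq ?_ (by positivity)
        rw [div_pow, Real.sq_sqrt hΛ0.le, le_div_iff₀ hΛ0]
        have h4 : Λ * ((x 0 - x₀ 0) / R) ^ 2 = (x 0 - x₀ 0) ^ 2 * Λ / R ^ 2 := by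
          rw [div_pow]; ring
        rw [h4, div_lt_iff₀ (by positivity)] at h2
        nlinarith [sq_nonneg R]
      rw [Set.indicator_of_mem (show x ∈ S from ⟨h3, hx1⟩), max_eq_left h.le]
      have h5 : saddle x₀ R Λ x ≤ 2 := by
        have : 0 ≤ Λ * ((x 0 - x₀ 0) / R) ^ 2 := by positivity
        unfold saddle; linarith
      nlinarith
  have hle : ∫ x in ball x₀ R, (max (saddle x₀ R Λ x) 0) ^ 2 ≤ 24 * R ^ 2 / √Λ := by
    have hI : Integrable (S.indicator fun _ : Plane => (4 : ℝ)) := hint.integrable_indicator hm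
    calc ∫ x in ball x₀ R, (max (saddle x₀ R Λ x) 0) ^ 2
        ≤ ∫ x in ball x₀ R, S.indicator (fun _ => 4) x :=
          integral_mono_of_nonneg (.of_forall fun x => sq_nonneg _) hI.integrableOn
            ((ae_restrict_iff' measurableSet_ball).2 (.of_forall hpt))
      _ ≤ ∫ x, S.indicator (fun _ => 4) x :=
          setIntegral_le_integral hI
            (.of_forall fun x => Set.indicator_nonneg (fun _ _ => by norm_num) x)
      _ = volume.real S * 4 := by
          rw [integral_indicator hm, setIntegral_const, smul_eq_mul]
      _ = _ := by rw [hvol]; field_simp; ring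
  refine le_of_sq_le_sq ?_ (by positivity)
  have h1 : (3 * Λ ^ (-(1 / 4) : ℝ)) ^ 2 = 9 / √Λ := by
    have h2 : (Λ ^ (-(1 / 4) : ℝ)) ^ 2 = (√Λ)⁻¹ := by
      rw [← Real.rpow_natCast, ← Real.rpow_mul hΛ0.le, Real.sqrt_eq_rpow, ← Real.rpow_neg hΛ0.le]
      norm_num
    rw [mul_pow, h2]
    ring
  rw [h1, posPartAvgNorm_sq x₀ hR, div_le_div_iff₀ (by positivity) hsq]
  rw [le_div_iff₀ hsq] at hle
  nlinarith [Real.pi_gt_three, sq_pos_of_pos hR]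

end saddle

/-- Applied to the saddles, the estimate would give `1 ≤ 3|c| Λ^(θ - 1/4)`, whose right side tends
to zero as `Λ → ∞`. The absolute value covers constants of either sign. -/
theorem not_localMaxEstimate (x₀ : Plane) {R : ℝ} (hR : 0 < R) {θ : ℝ} (hθ : θ < 1 / 4) (c : ℝ) :
    ¬ LocalMaxEstimate x₀ R c θ := by
  intro h
  have hbd : ∀ Λ : ℝ, 1 ≤ Λ → 1 ≤ 3 * |c| * Λ ^ (-(1 / 4 - θ)) := by
    intro Λ hΛ
    have hΛ0 : 0 < Λ := by linarith
    have h1 := (one_le_supOn_saddle x₀ (Λ := Λ) hR).trans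
      (h 1 Λ one_pos hΛ _ (isEllipticOn_diagonal _ hΛ) (saddle x₀ R Λ)
        ⟨_, hasW12Gradient_of_contDiff (contDiff_saddle x₀ R Λ) x₀ R⟩ (isSubsolution_saddle x₀))
    rw [← EReal.coe_one, EReal.coe_le_coe_iff, div_one] at h1
    calc 1 ≤ c * Λ ^ θ * posPartAvgNorm (ball x₀ R) (saddle x₀ R Λ) := h1
      _ ≤ |c| * Λ ^ θ * (3 * Λ ^ (-(1 / 4) : ℝ)) := by
          refine mul_le_mul ?_ (posPartAvgNorm_saddle_le x₀ hR hΛ)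
            (posPartAvgNorm_nonneg _ _ _) (by positivity)
          exact mul_le_mul_of_nonneg_right (le_abs_self c) (by positivity)
      _ = 3 * |c| * (Λ ^ θ * Λ ^ (-(1 / 4) : ℝ)) := by ring
      _ = _ := by
          rw [← Real.rpow_add hΛ0]
          congr 2
          ring
  have hlim : Filter.Tendsto (fun Λ : ℝ => 3 * |c| * Λ ^ (-(1 / 4 - θ))) Filter.atTop (nhds 0) := by
    simpa using (tendsto_rpow_neg_atTop (show 0 < 1 / 4 - θ by linarith)).const_mul (3 * |c|)
  obtain ⟨Λ, h1, h2⟩ := ((hlim.eventually (gt_mem_nhds one_pos)).and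
    (Filter.eventually_ge_atTop 1)).exists
  exact (hbd Λ h2).not_gt h1

theorem proposition2 :
    -- the estimate with exponent `1/4`, with a universal constant
    (∃ c : ℝ, ∀ (x₀ : Plane) (R : ℝ), 0 < R → LocalMaxEstimate x₀ R c (1 / 4)) ∧
    -- on no ball is there a finite constant for a smaller exponent
    (∀ (x₀ : Plane) (R : ℝ), 0 < R → ∀ θ : ℝ, θ < 1 / 4 → ¬ ∃ c : ℝ, LocalMaxEstimate x₀ R c θ) ∧
    -- the example `v = 1 + x₂² - Λ x₁²`, `a = diag(1, Λ)` on the unit ball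
    (∃ c₀ : ℝ, 0 < c₀ ∧ ∀ Λ : ℝ, 1 ≤ Λ →
      ∀ (a : Plane → Matrix (Fin 2) (Fin 2) ℝ) (v : Plane → ℝ),
        a = (fun _ => Matrix.diagonal ![1, Λ]) →
        v = (fun x => 1 + (x 1) ^ 2 - Λ * (x 0) ^ 2) →
        IsEllipticOn (ball 0 1) 1 Λ a ∧ MemW12 (ball 0 1) v ∧ IsSubsolution (ball 0 1) a v ∧
        0 < posPartAvgNorm (ball 0 1) v ∧
        ((c₀ * Λ ^ (1 / 4 : ℝ) * posPartAvgNorm (ball 0 1) v : ℝ) : EReal)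
          ≤ supOn (ball 0 (1 / 2)) v) := by
  -- The value `1/3` for `c₀` is the reciprocal of the factor in `posPartAvgNorm_saddle_le`.
  refine ⟨⟨700, fun x₀ R hR => localMaxEstimate_quarter x₀ hR⟩,
    fun x₀ R hR θ hθ ⟨c, hc⟩ => not_localMaxEstimate x₀ hR hθ c hc, 1 / 3, by norm_num, ?_⟩
  rintro Λ hΛ a v rfl hv
  have hv' : v = saddle 0 1 Λ := by
    rw [hv]
    funext x
    simp [saddle]
  rw [hv']
  have hΛ0 : 0 < Λ := by linarith
  refine ⟨isEllipticOn_diagonal _ hΛ,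
    ⟨_, hasW12Gradient_of_contDiff (contDiff_saddle 0 1 Λ) 0 1⟩, isSubsolution_saddle 0,
    posPartAvgNorm_saddle_pos 0 one_pos, le_trans ?_ (one_le_supOn_saddle 0 one_pos)⟩
  rw [← EReal.coe_one, EReal.coe_le_coe_iff]
  calc 1 / 3 * Λ ^ (1 / 4 : ℝ) * posPartAvgNorm (ball 0 1) (saddle 0 1 Λ)
      ≤ 1 / 3 * Λ ^ (1 / 4 : ℝ) * (3 * Λ ^ (-(1 / 4) : ℝ)) :=
        mul_le_mul_of_nonneg_left (posPartAvgNorm_saddle_le 0 one_pos hΛ) (by positivity)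
    _ = Λ ^ (1 / 4 : ℝ) * Λ ^ (-(1 / 4) : ℝ) := by ring
    _ = 1 := by
        rw [← Real.rpow_add hΛ0]
        norm_num
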